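/- Let $G=(V,E)$ be a finite graph without self-loops or multiple edges, drawn in the plane $\mathbb R^2\cong\mathbb C$: the vertices are distinct points, each edge $uv$ is the straight segment between $u$ and $v$, and no vertex other than $u,v$ lies on it. Edges may cross, i.e. meet in a point that is not a vertex. A set $F\subseteq E$ is even if every vertex has even degree in $(V,F)$; $C_F$ is the number of unordered pairs of edges in $F$ that cross each other. A closed path is a sequence $(v_0,\dots,v_{n-1})$ of vertices, $n\ge 3$, with $v_iv_{i+1}\in E$ and $v_{i+2}\ne v_i$ for all $i$ (indices modulo $n$). Order the vertices lexicographically by their coordinates; a loop is a closed path that is lexicographically smallest among all rotations of itself and of its reversal. Put $\alpha(\ell)=\sum_{i=0}^{n-1}\angle(v_{i+1}-v_i,\,v_{i+2}-v_{i+1})$, where $\angle\in(-\pi,\pi)$ is the turning angle, and $\operatorname{sgn}(\ell)=-\exp\bigl(\tfrac i2\alpha(\ell)\bigr)$. For edge weights $x=(x_{uv})_{uv\in E}$ in $\mathbb C$, put $w(\ell;x)=\frac{\operatorname{sgn}(\ell)}{m(\ell)}\prod_{i=0}^{n-1}x_{v_iv_{i+1}}$, where $m(\ell)$ is $n$ divided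 by the smallest period of the cyclic sequence. A loop is edge-disjoint if its edges $v_iv_{i+1}$, $0\le i<n$, are pairwise distinct. An edge-disjoint collection is a finite set $\{\ell_1,\dots,\ell_s\}$ ($s\ge 0$) of edge-disjoint loops no two of which share an edge, and $\operatorname{sgn}\{\ell_1,\dots,\ell_s\}=\prod_{i}\operatorname{sgn}(\ell_i)$. Let $\mathcal D(F)$ be the set of edge-disjoint collections whose loops together traverse exactly the edges in $F$. (1) For every even $F\subseteq E$, $$\sum_{\{\ell_1,\dots,\ell_s\}\in\mathcal D(F)}\operatorname{sgn}\{\ell_1,\dots,\ell_s\}=(-1)^{C_F}.$$ (2) Let $E_A\subseteq E$ be a set of edges such that $(V,E_A)$ has no cycles. Let the length of a loop be the number of its steps along edges in $E\setminus E_A$, and let $\mathcal D_r$ be the set of edge-disjoint collections of total length $r$. Then for all edge weights $x$ the series below converges, and $$Z(x):=\sum_{\text{even }F\subseteq E}(-1)^{C_F}\prod_{uv\in F}x_{uv}=1+\sum_{r=1}^{\infty}\ \sum_{\{\ell_1,\dots,\ell_s\}\in\mathcal D_r}\ \prod_{i=1}^s w(\ell_i;x).$$ -/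

import Mathlib

namespace SignedLoops

/-- A straight-line drawing of a (finite, simple, not necessarily planar) graph in the plane `ℂ`:
distinct vertices are distinct points, edges are the straight segments between their endpoints, and
apart from its two endpoints no vertex lies on an edge. Edges may cross. -/
structure Drawing {V : Type*} (G : SimpleGraph V) where
  pos : V → ℂ
  pos_injective : Function.Injective pos
  notMem_edge : ∀ u v w : V, G.Adj u v → w ≠ u → w ≠ v → pos w ∉ segment ℝ (pos u) (pos v)

section Paths

variable {V : Type*}

/-- A (non-backtracking) path `(v₀, …, vₙ₋₁)`. -/
def IsPath (G : SimpleGraph V) (l : List V) : Prop :=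
  l.IsChain G.Adj ∧ ∀ (i : ℕ) (h : i + 2 < l.length), l[i + 2] ≠ l[i]

/-- A closed path: all rotations are paths. A closed non-backtracking path in a simple graph has at
least three steps; the bound excludes the degenerate sequences of at most two vertices, all of whose
rotations are paths for lack of conditions. -/
def IsClosedPath (G : SimpleGraph V) (l : List V) : Prop :=
  3 ≤ l.length ∧ ∀ k : ℕ, IsPath G (l.rotate k)

/-- The list of the edges `vᵢvᵢ₊₁`, `0 ≤ i < n`, indices modulo `n`. -/
def edgeList (l : List V) : List (Sym2 V) :=
  List.zipWith (fun u v => s(u, v)) l (l.rotate 1)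

/-- `vᵢvᵢ₊₁ ≠ vⱼvⱼ₊₁` for `i ≠ j`. -/
def IsEdgeDisjoint (l : List V) : Prop := (edgeList l).Nodup

/-- The number of steps divided by the smallest period of the cyclic sequence. -/
noncomputable def multiplicity (l : List V) : ℕ :=
  l.length / Function.minimalPeriod (fun m : List V => m.rotate 1) l

open scoped Classical in
/-- The number of steps along edges that do not belong to the set `A` of additional edges. -/
noncomputable def loopLength (A : Finset (Sym2 V)) (l : List V) : ℕ :=
  (edgeList l).countP (fun e => e ∉ A)

open scoped Classical in
/-- The set of edges traversed by a loop. -/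
noncomputable def loopEdges (l : List V) : Finset (Sym2 V) := (edgeList l).toFinset

end Paths

namespace Drawing

variable {V : Type*} {G : SimpleGraph V} (D : Drawing G)

/-- The coordinates of a vertex, as an element of `ℝ × ℝ` with the lexicographic order. -/
def coords (v : V) : Lex (ℝ × ℝ) := toLex ((D.pos v).re, (D.pos v).im)

/-- A loop: a closed path that is lexicographically smallest among all rotations of itself and of
its reversal, the vertices being ordered lexicographically by their coordinates. -/
def IsLoop (l : List V) : Prop :=
  IsClosedPath G l ∧
    ∀ l' : List V, (l' ~r l ∨ l' ~r l.reverse) → l.map D.coords ≤ l'.map D.coords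

/-- The turning angle from `v - u` to `w - v`. -/
noncomputable def turn (u v w : V) : ℝ :=
  Complex.arg ((D.pos w - D.pos v) / (D.pos v - D.pos u))

/-- The sum of the turning angles at `(vᵢ, vᵢ₊₁, vᵢ₊₂)`, `0 ≤ i < n`, indices modulo `n`. -/
noncomputable def windingAngle (l : List V) : ℝ :=
  ((l.zip ((l.rotate 1).zip (l.rotate 2))).map (fun t => D.turn t.1 t.2.1 t.2.2)).sum

/-- `sgn(ℓ) = - exp(i α(ℓ) / 2)`. -/
noncomputable def sgn (l : List V) : ℂ :=
  -Complex.exp (Complex.I / 2 * (D.windingAngle l : ℂ))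

/-- The signed weight of a loop. -/
noncomputable def weight (x : Sym2 V → ℂ) (l : List V) : ℂ :=
  D.sgn l / (multiplicity l : ℂ) * ((edgeList l).map x).prod

/-- The closed segment that represents an edge. -/
def edgeSegment (e : Sym2 V) : Set ℂ :=
  Sym2.lift ⟨fun u v => segment ℝ (D.pos u) (D.pos v), fun _ _ => segment_symm ℝ _ _⟩ e

/-- Two distinct edges cross if they meet in a point which is not a vertex. -/
def Cross (e f : Sym2 V) : Prop :=
  e ≠ f ∧ ∃ p : ℂ, p ∈ D.edgeSegment e ∧ p ∈ D.edgeSegment f ∧ p ∉ Set.range D.pos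

open scoped Classical in
/-- `C_F`, the number of unordered pairs of edges in `F` that cross each other. -/
noncomputable def crossings (F : Finset (Sym2 V)) : ℕ :=
  ((F.powersetCard 2).filter (fun P => ∃ e f, P = {e, f} ∧ D.Cross e f)).card

end Drawing

section Finite

variable {V : Type*} [Fintype V]

open scoped Classical in
/-- The even subsets of the edge set. -/
noncomputable def evenSubsets (G : SimpleGraph V) : Finset (Finset (Sym2 V)) :=
  G.edgeFinset.powerset.filter (fun F => ∀ v : V, Even (F.filter (fun e => v ∈ e)).card)

/-- The generating function `Z(x)` of even subgraphs. -/
noncomputable def Drawing.Z {G : SimpleGraph V} (D : Drawing G) (x : Sym2 V → ℂ) : ℂ :=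
  ∑ F ∈ evenSubsets G, (-1) ^ D.crossings F * ∏ e ∈ F, x e

/-- A finite graph has only finitely many edge-disjoint loops. -/
theorem finite_edgeDisjointLoops {G : SimpleGraph V} (D : Drawing G) :
    {l : List V | D.IsLoop l ∧ IsEdgeDisjoint l}.Finite := by
  classical
  refine (List.finite_length_le V (Fintype.card (Sym2 V))).subset ?_
  rintro l ⟨-, h⟩
  have h1 := List.Nodup.length_le_card h
  simpa [edgeList] using h1

/-- The set of all edge-disjoint loops. -/
noncomputable def Drawing.edgeDisjointLoops {G : SimpleGraph V} (D : Drawing G) :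
    Finset (List V) :=
  (finite_edgeDisjointLoops D).toFinset

open scoped Classical in
/-- All edge-disjoint collections of loops: finite sets of edge-disjoint loops, no two of which
visit a common edge. -/
noncomputable def Drawing.edgeDisjointCollections {G : SimpleGraph V} (D : Drawing G) :
    Finset (Finset (List V)) :=
  D.edgeDisjointLoops.powerset.filter
    (fun S => ∀ l ∈ S, ∀ l' ∈ S, l ≠ l' → Disjoint (loopEdges l) (loopEdges l'))

open scoped Classical in
/-- The edge-disjoint collections whose loops together traverse exactly the edges in `F`. -/
noncomputable def Drawing.decompositions {G : SimpleGraph V} (D : Drawing G)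
    (F : Finset (Sym2 V)) : Finset (Finset (List V)) :=
  D.edgeDisjointCollections.filter (fun S => S.biUnion loopEdges = F)

/-- The sign of an edge-disjoint collection of loops. -/
noncomputable def Drawing.collectionSgn {G : SimpleGraph V} (D : Drawing G)
    (S : Finset (List V)) : ℂ :=
  ∏ l ∈ S, D.sgn l

open scoped Classical in
/-- The edge-disjoint collections of total length `r`, where `A` is the set of additional edges. -/
noncomputable def Drawing.collectionsOfLength {G : SimpleGraph V} (D : Drawing G)
    (A : Finset (Sym2 V)) (r : ℕ) : Finset (Finset (List V)) :=
  D.edgeDisjointCollections.filter (fun S => ∑ l ∈ S, loopLength A l = r)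

end Finite

end SignedLoops

/-! Cut each edge of an even set `F` into two half-edges and place all half-edges on a line: by
their vertex in lexicographic order, and clockwise at each vertex (`key`). Decomposing `F` into
edge-disjoint loops amounts to choosing, at each vertex, a perfect matching of its half-edges:
arriving through one half-edge, a loop leaves through its partner (`sum_decompositions_eq`). Edges
and transitions both become chords with endpoints on the line, and `matchSign` is the parity of the
number of crossings in such a system of chords.

The central identity, `collectionSgn_eq`, says that the sign of a collection is the crossing parity
of its edge chords times that of its transition chords. Two facts give it. Geometrically, the half
turning angles telescope around a loop, leaving `-1` times one factor for the orientation of each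
edge chord and each transition chord along the line (`exp_turn`, `sgn_listOf`). Combinatorially, the
cyclic list of half-edges met along a loop splits into consecutive pairs in two ways, the edge
chords and the transition chords, which differ by a rotation by one place. As the list has even
length, this rotation changes the sign of the arrangement once for each loop, and comparing
arrangements yields the same product of orientations (`chordSign_mul_chordSign_flatMap`).

The first parity does not depend on the matching. Edge chords and edges cross equally often modulo
two, up to corrections recording on which side of an edge a vertex lies; in an even set each
correction occurs an even number of times (`matchSign_swap`). The second parity, summed over all
matchings, gives `1`, because the half-edges at a vertex form an interval of even size
(`sum_matchSign`, in effect the expansion of a Pfaffian along its first row). Together these prove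
(1).

For (2), the edges of a collection form an even set, so grouping collections by the set they cover
turns (1) into a finite formula for `Z`. An edge-disjoint loop has multiplicity one and cannot stay
inside a forest, so only the empty collection has length zero, and sorting by length leaves finitely
many nonzero terms. -/

namespace SignedLoops

/-! ### Products over pairs of list entries -/

section PairProd

variable {α β M : Type*} [CommMonoid M]

/-- The product of `c xᵢ xⱼ` over all positions `i < j` of a list. -/
def pairProd (c : α → α → M) : List α → M
  | [] => 1
  | x :: xs => (xs.map (c x)).prod * pairProd c xs

/-- The product of `c x y` over all `x` in the first and `y` in the second list. -/
def crossProd (c : α → α → M) (xs ys : List α) : M :=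
  (xs.map fun x => (ys.map (c x)).prod).prod

theorem pairProd_append (c : α → α → M) (xs ys : List α) :
    pairProd c (xs ++ ys) = pairProd c xs * pairProd c ys * crossProd c xs ys := by
  induction xs with
  | nil => simp [pairProd, crossProd]
  | cons x xs ih =>
    simp only [List.cons_append, pairProd, List.map_append, List.prod_append, ih, crossProd,
      List.map_cons, List.prod_cons]
    ac_rfl

theorem crossProd_perm (c : α → α → M) {xs xs' ys ys' : List α} (h : xs.Perm xs')
    (h' : ys.Perm ys') : crossProd c xs ys = crossProd c xs' ys' := by
  unfold crossProd
  have : (fun x => (ys.map (c x)).prod) = fun x => (ys'.map (c x)).prod :=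
    funext fun x => (h'.map (c x)).prod_eq
  rw [this]
  exact (h.map _).prod_eq

theorem pairProd_perm (c : α → α → M) {xs ys : List α} (h : xs.Perm ys)
    (hc : ∀ x ∈ xs, ∀ y ∈ xs, c x y = c y x) : pairProd c xs = pairProd c ys := by
  induction h with
  | nil => rfl
  | cons x h ih =>
    simp only [pairProd]
    rw [ih (fun a ha b hb => hc a (by simp [ha]) b (by simp [hb])), (h.map _).prod_eq]
  | swap x y l =>
    simp only [pairProd, List.map_cons, List.prod_cons]
    rw [hc x (by simp) y (by simp)]
    ac_rfl
  | trans h₁ h₂ ih₁ ih₂ =>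
    rw [ih₁ hc, ih₂ fun a ha b hb => hc a (h₁.mem_iff.2 ha) b (h₁.mem_iff.2 hb)]

theorem pairProd_map (c : β → β → M) (g : α → β) (xs : List α) :
    pairProd c (xs.map g) = pairProd (fun x y => c (g x) (g y)) xs := by
  induction xs with
  | nil => rfl
  | cons x xs ih => simp [pairProd, ih, Function.comp_def]

theorem pairProd_congr {c c' : α → α → M} {xs : List α}
    (h : xs.Pairwise fun x y => c x y = c' x y) : pairProd c xs = pairProd c' xs := by
  induction xs with
  | nil => rfl
  | cons x xs ih =>
    rw [List.pairwise_cons] at h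
    simp only [pairProd]
    rw [ih h.2, List.map_congr_left h.1]

theorem pairProd_mul (c c' : α → α → M) (xs : List α) :
    pairProd (fun x y => c x y * c' x y) xs = pairProd c xs * pairProd c' xs := by
  induction xs with
  | nil => simp [pairProd]
  | cons x xs ih =>
    simp only [pairProd, ih, List.prod_map_mul]
    ac_rfl

/-- A product over unordered pairs of `g x y * g y x` is a product over ordered pairs. -/
theorem pairProd_mul_swap (g : α → α → M) (xs : List α) (hg : ∀ x ∈ xs, g x x = 1) :
    pairProd (fun x y => g x y * g y x) xs = crossProd g xs xs := by
  induction xs with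
  | nil => simp [pairProd, crossProd]
  | cons x xs ih =>
    have ih := ih fun y hy => hg y (by simp [hy])
    simp only [crossProd] at ih
    simp only [pairProd, ih, crossProd, List.map_cons, List.prod_cons, List.prod_map_mul,
      hg x (by simp), one_mul]
    ac_rfl

end PairProd

/-! ### Chords over a line and the rotation that exchanges two matchings -/

section Chords

variable {α : Type*}

/-- The list of the endpoints of a list of chords. -/
def endpoints (K : List (α × α)) : List α := K.flatMap fun k => [k.1, k.2]

/-- The sign `-1` if exactly one endpoint of the second chord is between those of the first. -/
def chordSign (s : α → α → ℤˣ) (k k' : α × α) : ℤˣ :=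
  s k.1 k'.1 * s k.1 k'.2 * (s k.2 k'.1 * s k.2 k'.2)

theorem endpoints_cons (k : α × α) (K : List (α × α)) :
    endpoints (k :: K) = k.1 :: k.2 :: endpoints K := rfl

theorem prod_map_endpoints {M : Type*} [CommMonoid M] (g : α → M) (K : List (α × α)) :
    ((endpoints K).map g).prod = (K.map fun k => g k.1 * g k.2).prod := by
  induction K with
  | nil => rfl
  | cons k K ih => simp [endpoints_cons, ih, mul_assoc]

theorem mem_endpoints {K : List (α × α)} {x : α} :
    x ∈ endpoints K ↔ ∃ k ∈ K, x = k.1 ∨ x = k.2 := by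
  simp [endpoints]

theorem endpoints_flatMap {ι : Type*} (E : ι → List (α × α)) (L : List ι) :
    endpoints (L.flatMap E) = L.flatMap fun l => endpoints (E l) := by
  simp [endpoints, List.flatMap_assoc]

/-- A pair of endpoints belongs either to one chord or to two different chords; the four pairs
between two chords multiply to `chordSign`. This separates orientations from crossings. -/
theorem pairProd_endpoints (s : α → α → ℤˣ) (K : List (α × α)) :
    pairProd s (endpoints K) = (K.map fun k => s k.1 k.2).prod * pairProd (chordSign s) K := by
  induction K with
  | nil => simp [endpoints, pairProd]
  | cons k K ih =>
    have key : (K.map (chordSign s k)).prod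
        = ((endpoints K).map (s k.1)).prod * ((endpoints K).map (s k.2)).prod := by
      rw [prod_map_endpoints, prod_map_endpoints, ← List.prod_map_mul]
      rfl
    rw [endpoints_cons]
    simp only [pairProd, List.map_cons, List.prod_cons, ih, key]
    ac_rfl

/-- Moving `a` past an entry of `L` reverses one pair, and by antisymmetry each reversal costs a
sign. -/
theorem pairProd_rotate (s : α → α → ℤˣ) (a : α) (L : List α) (h : ∀ y ∈ L, s y a = -s a y) :
    pairProd s (L ++ [a]) = (-1) ^ L.length * pairProd s (a :: L) := by
  have key : crossProd s L [a] = (-1) ^ L.length * (L.map (s a)).prod := by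
    induction L with
    | nil => simp [crossProd]
    | cons y L ih =>
      have ih := ih fun z hz => h z (by simp [hz])
      simp only [crossProd, List.map_cons, List.map_nil, List.prod_cons, List.prod_nil, mul_one,
        List.length_cons, pow_succ] at ih ⊢
      rw [ih, h y (by simp)]
      simp only [mul_neg, neg_mul, mul_one]
      congr 1
      ac_rfl
  rw [pairProd_append, key]
  simp only [pairProd, List.map_nil, List.prod_nil, mul_one]
  ac_rfl

/-- Rotating the endpoints of finitely many closed chains of chords by one position, which exchanges
the two matchings of each chain, changes the sign of the arrangement once for each chain. -/
theorem pairProd_endpoints_flatMap {ι : Type*} (s : α → α → ℤˣ) (E T : ι → List (α × α))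
    (L : List ι) (h : ∀ l ∈ L, ∃ a M, endpoints (E l) = a :: M ∧ endpoints (T l) = M ++ [a] ∧
      Odd M.length ∧ ∀ y ∈ M, s y a = -s a y) :
    pairProd s (endpoints (L.flatMap E))
      = (-1) ^ L.length * pairProd s (endpoints (L.flatMap T)) := by
  have hperm : ∀ l ∈ L, (endpoints (E l)).Perm (endpoints (T l)) := by
    intro l hl
    obtain ⟨a, M, h1, h2, -⟩ := h l hl
    rw [h1, h2]
    exact (List.perm_append_singleton a M).symm
  simp only [endpoints_flatMap]
  induction L with
  | nil => simp
  | cons l L ih =>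
    have ih := ih (fun k hk => h k (by simp [hk])) fun k hk => hperm k (by simp [hk])
    simp only [List.flatMap_cons, pairProd_append, ih, List.length_cons, pow_succ]
    -- Pairs from different chains contribute the same on both sides, since `crossProd` sees each
    -- list only up to permutation.
    rw [crossProd_perm s (hperm l (by simp))
      (List.Perm.flatMap_left L fun k hk => hperm k (by simp [hk]))]
    obtain ⟨a, M, h1, h2, h3, h4⟩ := h l (by simp)
    rw [h1, h2, pairProd_rotate s a M h4, h3.neg_one_pow]
    simp only [mul_neg, neg_mul, mul_one, one_mul, neg_neg]
    ac_rfl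

/-- Splitting both arrangement signs of `pairProd_endpoints_flatMap` by `pairProd_endpoints` and
collecting crossings on one side gives the formula, because every unit of `ℤ` is its own inverse.
The right side is the form in which `sgn_listOf` presents the signs of loops. -/
theorem chordSign_mul_chordSign_flatMap {ι : Type*} (s : α → α → ℤˣ) (E T : ι → List (α × α))
    (L : List ι) (h : ∀ l ∈ L, ∃ a M, endpoints (E l) = a :: M ∧ endpoints (T l) = M ++ [a] ∧
      Odd M.length ∧ ∀ y ∈ M, s y a = -s a y) :
    pairProd (chordSign s) (L.flatMap E) * pairProd (chordSign s) (L.flatMap T)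
      = (L.map fun l => -(((E l).map fun k => s k.1 k.2).prod *
          ((T l).map fun k => s k.1 k.2).prod)).prod := by
  have h1 := pairProd_endpoints_flatMap s E T L h
  rw [pairProd_endpoints, pairProd_endpoints] at h1
  have key : ∀ L : List ι, (L.map fun l => -(((E l).map fun k => s k.1 k.2).prod *
          ((T l).map fun k => s k.1 k.2).prod)).prod = (-1) ^ L.length *
      (((L.flatMap E).map fun k => s k.1 k.2).prod *
        ((L.flatMap T).map fun k => s k.1 k.2).prod) := by
    intro L
    induction L with
    | nil => simp
    | cons l L ih =>
      simp only [List.map_cons, List.prod_cons, ih, List.flatMap_cons, List.map_append,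
        List.prod_append, List.length_cons, pow_succ, mul_neg, neg_mul, mul_one]
      congr 1
      ac_rfl
  rw [key]
  generalize ((L.flatMap E).map fun k => s k.1 k.2).prod = x at *
  generalize ((L.flatMap T).map fun k => s k.1 k.2).prod = y at *
  generalize pairProd (chordSign s) (L.flatMap E) = p at *
  generalize pairProd (chordSign s) (L.flatMap T) = q at *
  generalize ((-1 : ℤˣ)) ^ L.length = t at *
  have hx := Int.units_mul_self x
  have hq := Int.units_mul_self q
  calc p * q = (x * x) * p * q := by rw [hx, one_mul]
    _ = x * (x * p) * q := by ac_rfl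
    _ = t * (x * y) * (q * q) := by rw [h1]; ac_rfl
    _ = _ := by rw [hq, mul_one]

end Chords

/-! ### Signed count of perfect matchings -/

section Matchings

variable {α β γ : Type*} [LinearOrder β]

/-- `1` if `x` precedes `y` in the order given by `κ`, and `-1` otherwise. -/
def ordSign (κ : α → β) (x y : α) : ℤˣ := if κ x < κ y then 1 else -1

theorem ordSign_swap {κ : α → β} {x y : α} (h : κ x ≠ κ y) :
    ordSign κ y x = -ordSign κ x y := by
  unfold ordSign
  rcases lt_or_gt_of_ne h with h | h
  · rw [if_pos h, if_neg h.not_gt]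
  · rw [if_pos h, if_neg h.not_gt, neg_neg]

theorem chordSign_swap_left (s : α → α → ℤˣ) (a b : α) (k : α × α) :
    chordSign s (a, b) k = chordSign s (b, a) k := by
  simp only [chordSign]
  ac_rfl

theorem chordSign_swap_right (s : α → α → ℤˣ) (a b : α) (k : α × α) :
    chordSign s k (a, b) = chordSign s k (b, a) := by
  simp only [chordSign]
  ac_rfl

/-- Each of the four factors changes sign, and four is even. -/
theorem chordSign_comm {κ : α → β} {k k' : α × α} (h11 : κ k.1 ≠ κ k'.1) (h12 : κ k.1 ≠ κ k'.2)
    (h21 : κ k.2 ≠ κ k'.1) (h22 : κ k.2 ≠ κ k'.2) :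
    chordSign (ordSign κ) k k' = chordSign (ordSign κ) k' k := by
  simp only [chordSign, ordSign_swap h11, ordSign_swap h12, ordSign_swap h21, ordSign_swap h22,
    mul_neg, neg_mul, neg_neg]
  ac_rfl

open scoped Classical in
/-- The left endpoints of the chords `{x, f x}`, `x ∈ H`. -/
noncomputable def leftEnds (κ : α → β) (H : Finset α) (f : α → α) : Finset α :=
  H.filter fun x => κ x < κ (f x)

/-- The parity of the number of pairs of crossing chords `{x, f x}`, `x ∈ H`. -/
noncomputable def matchSign (κ : α → β) (H : Finset α) (f : α → α) : ℤˣ :=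
  pairProd (fun x y => chordSign (ordSign κ) (x, f x) (y, f y)) (leftEnds κ H f).toList

/-- Neither the direction of a chord nor the order of two chords affects their sign, so any list
containing each chord once computes `matchSign`. Loops supply such lists directly, with chords
directed along the loop. -/
theorem pairProd_chordSign_eq_matchSign {κ : α → β} {H : Finset α} (hκ : Set.InjOn κ H)
    {f : α → α} {K : List (α × α)} (hK : (endpoints K).Nodup)
    (hKf : ∀ k ∈ K, f k.1 = k.2 ∧ f k.2 = k.1) (hmem : ∀ x, x ∈ endpoints K ↔ x ∈ H) :
    pairProd (chordSign (ordSign κ)) K = matchSign κ H f := by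
  classical
  -- The left end of a chord, which represents it in `leftEnds`.
  let m : α × α → α := fun k => if κ k.1 < κ k.2 then k.1 else k.2
  have hH : ∀ k ∈ K, k.1 ∈ H ∧ k.2 ∈ H := fun k hk =>
    ⟨(hmem _).1 (mem_endpoints.2 ⟨k, hk, .inl rfl⟩), (hmem _).1 (mem_endpoints.2 ⟨k, hk, .inr rfl⟩)⟩
  have hsub : (K.map m).Sublist (endpoints K) := by
    clear * -
    induction K with
    | nil => simp [endpoints]
    | cons k K ih =>
      rw [endpoints_cons, List.map_cons]
      by_cases h : κ k.1 < κ k.2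
      · simp only [m, if_pos h]
        exact (ih.cons _).cons_cons _
      · simp only [m, if_neg h]
        exact (ih.cons_cons _).cons _
  have hne : ∀ k ∈ K, k.1 ≠ k.2 := by
    clear * - hK
    induction K with
    | nil => simp
    | cons k K ih =>
      rw [endpoints_cons, List.nodup_cons, List.nodup_cons] at hK
      intro k' hk'
      rcases List.mem_cons.1 hk' with rfl | h
      · exact fun e => hK.1 (by simp [e])
      · exact ih hK.2.2 k' h
  have hperm : (K.map m).Perm (leftEnds κ H f).toList := by
    rw [List.perm_ext_iff_of_nodup (hsub.nodup hK) (Finset.nodup_toList _)]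
    intro x
    simp only [List.mem_map, Finset.mem_toList, leftEnds, Finset.mem_filter]
    constructor
    · rintro ⟨k, hk, rfl⟩
      by_cases h : κ k.1 < κ k.2
      · simp only [m, if_pos h]
        exact ⟨(hH k hk).1, by rwa [(hKf k hk).1]⟩
      · simp only [m, if_neg h]
        refine ⟨(hH k hk).2, ?_⟩
        rw [(hKf k hk).2]
        exact lt_of_le_of_ne (not_lt.1 h)
          fun e => hne k hk (hκ (hH k hk).2 (hH k hk).1 e).symm
    · rintro ⟨hx, hlt⟩
      obtain ⟨k, hk, rfl | rfl⟩ := mem_endpoints.1 ((hmem x).2 hx)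
      · rw [(hKf k hk).1] at hlt
        exact ⟨k, hk, if_pos hlt⟩
      · rw [(hKf k hk).2] at hlt
        exact ⟨k, hk, if_neg hlt.not_gt⟩
  have hchord : ∀ k ∈ K, ∀ k' : α × α,
      chordSign (ordSign κ) k k' = chordSign (ordSign κ) (m k, f (m k)) k' ∧
      chordSign (ordSign κ) k' k = chordSign (ordSign κ) k' (m k, f (m k)) := by
    intro k hk k'
    by_cases h : κ k.1 < κ k.2
    · simp only [m, if_pos h, (hKf k hk).1, and_self]
    · simp only [m, if_neg h, (hKf k hk).2]
      exact ⟨chordSign_swap_left _ _ _ _, chordSign_swap_right _ _ _ _⟩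
  have hcongr : pairProd (chordSign (ordSign κ)) K
      = pairProd (fun x y => chordSign (ordSign κ) (x, f x) (y, f y)) (K.map m) := by
    rw [pairProd_map]
    apply pairProd_congr
    rw [List.pairwise_iff_forall_sublist]
    intro k k' hs
    have h1 : k ∈ K := hs.subset (by simp)
    have h2 : k' ∈ K := hs.subset (by simp)
    rw [(hchord k h1 k').1, (hchord k' h2 _).2]
  rw [hcongr, matchSign]
  apply pairProd_perm _ hperm
  intro x hx y hy
  by_cases hxy : x = y
  · rw [hxy]
  obtain ⟨hxH, hxl⟩ := Finset.mem_filter.1 (Finset.mem_toList.1 (hperm.mem_iff.1 hx))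
  obtain ⟨hyH, hyl⟩ := Finset.mem_filter.1 (Finset.mem_toList.1 (hperm.mem_iff.1 hy))
  have hf : ∀ z ∈ H, f z ∈ H ∧ f (f z) = z := by
    intro z hz
    obtain ⟨k, hk, rfl | rfl⟩ := mem_endpoints.1 ((hmem z).2 hz)
    · rw [(hKf k hk).1, (hKf k hk).2]
      exact ⟨(hH k hk).2, rfl⟩
    · rw [(hKf k hk).2, (hKf k hk).1]
      exact ⟨(hH k hk).1, rfl⟩
  have hinj : ∀ {z w}, z ∈ H → w ∈ H → z ≠ w → κ z ≠ κ w := fun hz hw hzw e => hzw (hκ hz hw e)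
  have hxfy : x ≠ f y := by
    rintro rfl
    rw [(hf y hyH).2] at hxl
    exact hxl.not_gt hyl
  have hyfx : y ≠ f x := by
    rintro rfl
    rw [(hf x hxH).2] at hyl
    exact hyl.not_gt hxl
  apply chordSign_comm
  · exact hinj hxH hyH hxy
  · exact hinj hxH (hf y hyH).1 hxfy
  · exact hinj (hf x hxH).1 hyH hyfx.symm
  · refine hinj (hf x hxH).1 (hf y hyH).1 fun e => hxy ?_
    change f x = f y at e
    rw [← (hf x hxH).2, e, (hf y hyH).2]

theorem exists_chords {κ : α → β} {H : Finset α} (hκ : Set.InjOn κ H) {f : α → α}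
    (hfH : ∀ x ∈ H, f x ∈ H) (hff : ∀ x ∈ H, f (f x) = x) (hne : ∀ x ∈ H, f x ≠ x) :
    ∃ K : List (α × α), (endpoints K).Nodup ∧ (∀ k ∈ K, f k.1 = k.2 ∧ f k.2 = k.1) ∧
      ∀ x, x ∈ endpoints K ↔ x ∈ H := by
  classical
  have hl : ∀ x ∈ leftEnds κ H f, x ∈ H ∧ κ x < κ (f x) := fun x hx => Finset.mem_filter.1 hx
  refine ⟨(leftEnds κ H f).toList.map fun x => (x, f x), ?_, ?_, ?_⟩
  · unfold endpoints
    rw [List.nodup_flatMap]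
    constructor
    · intro k hk
      obtain ⟨x, hx, rfl⟩ := List.mem_map.1 hk
      simpa using (hne x (hl x (Finset.mem_toList.1 hx)).1).symm
    · rw [List.pairwise_map]
      refine (Finset.nodup_toList _).imp_of_mem ?_
      intro x y hx hy hxy
      obtain ⟨hxH, hxl⟩ := hl x (Finset.mem_toList.1 hx)
      obtain ⟨hyH, hyl⟩ := hl y (Finset.mem_toList.1 hy)
      simp only [Function.onFun, List.disjoint_cons_left, List.mem_cons, List.not_mem_nil,
        or_false, not_or, List.disjoint_nil_left, and_true]
      refine ⟨⟨hxy, ?_⟩, ?_, ?_⟩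
      · rintro rfl
        rw [hff y hyH] at hxl
        exact hxl.not_gt hyl
      · rintro rfl
        rw [hff x hxH] at hyl
        exact hyl.not_gt hxl
      · intro e
        exact hxy (by rw [← hff x hxH, e, hff y hyH])
  · intro k hk
    obtain ⟨x, hx, rfl⟩ := List.mem_map.1 hk
    exact ⟨rfl, hff x (hl x (Finset.mem_toList.1 hx)).1⟩
  · intro x
    rw [mem_endpoints]
    constructor
    · rintro ⟨k, hk, h⟩
      obtain ⟨y, hy, rfl⟩ := List.mem_map.1 hk
      have hy := (hl y (Finset.mem_toList.1 hy)).1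
      rcases h with rfl | rfl
      · exact hy
      · exact hfH y hy
    · intro hx
      by_cases h : κ x < κ (f x)
      · exact ⟨(x, f x), List.mem_map.2 ⟨x, Finset.mem_toList.2 (Finset.mem_filter.2 ⟨hx, h⟩), rfl⟩,
          .inl rfl⟩
      · refine ⟨(f x, f (f x)), List.mem_map.2 ⟨f x, Finset.mem_toList.2
          (Finset.mem_filter.2 ⟨hfH x hx, ?_⟩), rfl⟩, .inr (hff x hx).symm⟩
        rw [hff x hx]
        exact lt_of_le_of_ne (not_lt.1 h) fun e => hne x hx (hκ (hfH x hx) hx e)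

-- The exponents are the ranks `0, 1, 2, …`, so the sum alternates. Removing the largest element
-- leaves the other ranks unchanged.
open scoped Classical in
theorem sum_neg_one_pow_rank (κ : α → β) (B : Finset α) (hκ : Set.InjOn κ B) :
    ∑ y ∈ B, (-1 : ℤ) ^ (B.filter fun z => κ z < κ y).card = if Even B.card then 0 else 1 := by
  induction B using Finset.induction_on_max_value κ with
  | empty => simp
  | insert a s ha hmax ih =>
    have ih := ih (hκ.mono (by simp))
    have hlt : ∀ y ∈ s, κ y < κ a := fun y hy =>
      lt_of_le_of_ne (hmax y hy) fun e => ha (hκ (by simp [hy]) (by simp) e ▸ hy)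
    rw [Finset.sum_insert ha, Finset.card_insert_of_notMem ha]
    have h1 : (insert a s).filter (fun z => κ z < κ a) = s := by
      rw [Finset.filter_insert, if_neg (lt_irrefl _), Finset.filter_true_of_mem hlt]
    have h2 : ∀ y ∈ s, (insert a s).filter (fun z => κ z < κ y) = s.filter fun z => κ z < κ y :=
      fun y hy => by rw [Finset.filter_insert, if_neg (hlt y hy).not_gt]
    rw [h1, Finset.sum_congr rfl fun y hy => by rw [h2 y hy], ih]
    rcases Nat.even_or_odd s.card with h | h
    · simp [h, h.neg_one_pow, Nat.even_add_one]
    · simp [h.neg_one_pow, Nat.even_add_one, Nat.not_even_iff_odd.2 h]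

open scoped Classical in
/-- The perfect matchings of `H`, as involutions, that only match elements of the same block. -/
noncomputable def matchings [Fintype α] (H : Finset α) (blk : α → γ) :
    Finset (Equiv.Perm α) :=
  Finset.univ.filter fun f =>
    (∀ x, f (f x) = x) ∧ (∀ x, f x = x ↔ x ∉ H) ∧ ∀ x, blk (f x) = blk x

theorem mem_matchings [Fintype α] {H : Finset α} {blk : α → γ} {f : Equiv.Perm α} :
    f ∈ matchings H blk ↔
      (∀ x, f (f x) = x) ∧ (∀ x, f x = x ↔ x ∉ H) ∧ ∀ x, blk (f x) = blk x := by
  simp [matchings]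

theorem apply_mem_of_mem_matchings [Fintype α] {H : Finset α} {blk : α → γ} {f : Equiv.Perm α}
    (hf : f ∈ matchings H blk) {x : α} (hx : x ∈ H) : f x ∈ H := by
  obtain ⟨h1, h2, -⟩ := mem_matchings.1 hf
  by_contra h
  have h3 := (h2 (f x)).2 h
  rw [h1] at h3
  exact (h2 x).1 h3.symm hx

theorem apply_ne_of_mem_matchings [Fintype α] {H : Finset α} {blk : α → γ} {f : Equiv.Perm α}
    (hf : f ∈ matchings H blk) {x : α} (hx : x ∈ H) : f x ≠ x :=
  fun h => ((mem_matchings.1 hf).2.1 x).1 h hx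

open scoped Classical in
theorem mul_swap_mem_matchings [Fintype α] {H : Finset α} {blk : α → γ} {f : Equiv.Perm α}
    (hf : f ∈ matchings H blk) {x : α} (hx : x ∈ H) :
    f * Equiv.swap x (f x) ∈ matchings ((H.erase x).erase (f x)) blk := by
  obtain ⟨h1, h2, h3⟩ := mem_matchings.1 hf
  have hne := apply_ne_of_mem_matchings hf hx
  have key : ∀ z, (f * Equiv.swap x (f x)) z = if z = x ∨ z = f x then z else f z := by
    intro z
    rw [Equiv.Perm.mul_apply]
    by_cases hzx : z = x
    · subst hzx
      simp [h1]
    · by_cases hzy : z = f x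
      · subst hzy
        simp
      · rw [Equiv.swap_apply_of_ne_of_ne hzx hzy, if_neg (by tauto)]
  rw [mem_matchings]
  refine ⟨fun z => ?_, fun z => ?_, fun z => ?_⟩
  · rw [key z]
    split_ifs with h
    · rw [key z, if_pos h]
    · rw [key, if_neg, h1]
      rintro (h' | h')
      · exact h (.inr (by rw [← h', h1]))
      · exact h (.inl (f.injective h'))
  · rw [key z]
    simp only [Finset.mem_erase, not_and]
    split_ifs with h
    · simp only [true_iff]
      tauto
    · rw [h2]
      tauto
  · rw [key z]
    split_ifs
    · rfl
    · exact h3 z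

-- The inverse of removing a pair: with `mul_swap_mem_matchings`, multiplication by `Equiv.swap x y`
-- is a bijection between the matchings that pair `x` with `y` and the matchings of the remaining
-- points.
open scoped Classical in
theorem mul_swap_mem_matchings_insert [Fintype α] {H : Finset α} {blk : α → γ} {x y : α}
    (hx : x ∈ H) (hy : y ∈ H) (hxy : x ≠ y) (hblk : blk y = blk x) {g : Equiv.Perm α}
    (hg : g ∈ matchings ((H.erase x).erase y) blk) :
    g * Equiv.swap x y ∈ matchings H blk ∧ (g * Equiv.swap x y) x = y := by
  obtain ⟨h1, h2, h3⟩ := mem_matchings.1 hg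
  have hgx : g x = x := (h2 x).2 (by simp)
  have hgy : g y = y := (h2 y).2 (by simp)
  have key : ∀ z, (g * Equiv.swap x y) z = if z = x then y else if z = y then x else g z := by
    intro z
    rw [Equiv.Perm.mul_apply, Equiv.swap_apply_def]
    split_ifs <;> simp [*]
  refine ⟨?_, by rw [key, if_pos rfl]⟩
  have hgz : ∀ z, z ≠ x → z ≠ y → g z ≠ x ∧ g z ≠ y := by
    intro z hzx hzy
    exact ⟨fun e => hzx (g.injective (e.trans hgx.symm)),
      fun e => hzy (g.injective (e.trans hgy.symm))⟩
  rw [mem_matchings]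
  refine ⟨fun z => ?_, fun z => ?_, fun z => ?_⟩
  · by_cases hzx : z = x
    · subst hzx
      rw [key z, if_pos rfl, key y, if_neg hxy.symm, if_pos rfl]
    · by_cases hzy : z = y
      · subst hzy
        rw [key z, if_neg hzx, if_pos rfl, key x, if_pos rfl]
      · rw [key z, if_neg hzx, if_neg hzy, key, if_neg (hgz z hzx hzy).1, if_neg (hgz z hzx hzy).2,
          h1]
  · rw [key z]
    split_ifs with hzx hzy
    · subst hzx
      simp [hx, hxy.symm]
    · subst hzy
      simp [hy, hxy]
    · rw [h2]
      simp [hzx, hzy]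
  · rw [key z]
    split_ifs with hzx hzy
    · rw [hzx, hblk]
    · rw [hzy, hblk]
    · exact h3 z

-- Since `x` comes first, a chord crosses `{x, f x}` exactly when one of its ends precedes `f x`. A
-- chord with both ends before `f x` adds two to the count of points, so counting points instead of
-- crossing chords preserves the parity.
open scoped Classical in
theorem matchSign_erase [Fintype α] {κ : α → β} {H : Finset α} (hκ : Set.InjOn κ H)
    {blk : α → γ} {f : Equiv.Perm α} (hf : f ∈ matchings H blk) {x : α} (hx : x ∈ H)
    (hmin : ∀ z ∈ H, κ x ≤ κ z) :
    matchSign κ H f = (-1) ^ (((H.erase x).erase (f x)).filter fun z => κ z < κ (f x)).card *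
      matchSign κ ((H.erase x).erase (f x)) (f * Equiv.swap x (f x) : Equiv.Perm α) := by
  set y := f x with hy
  set g := f * Equiv.swap x y with hgdef
  have hg : g ∈ matchings ((H.erase x).erase y) blk := mul_swap_mem_matchings hf hx
  have hyH : y ∈ H := apply_mem_of_mem_matchings hf hx
  have hyx : y ≠ x := apply_ne_of_mem_matchings hf hx
  set H' := (H.erase x).erase y with hH'
  have hκ' : Set.InjOn κ H' := hκ.mono fun z hz => by
    have : z ∈ (H.erase x).erase y := hz
    simp only [Finset.mem_erase] at this
    exact this.2.2
  obtain ⟨h1, h2, h3⟩ := mem_matchings.1 hf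
  have hfg : ∀ z ∈ H', f z = g z := by
    intro z hz
    simp only [hH', Finset.mem_erase] at hz
    rw [hgdef, Equiv.Perm.mul_apply, Equiv.swap_apply_of_ne_of_ne hz.2.1 hz.1]
  obtain ⟨K, hK1, hK2, hK3⟩ := exists_chords hκ' (f := g)
    (fun z hz => apply_mem_of_mem_matchings hg hz) (fun z _ => (mem_matchings.1 hg).1 z)
    fun z hz => apply_ne_of_mem_matchings hg hz
  have hKx : x ∉ endpoints K := fun h => by simpa [hH'] using (hK3 x).1 h
  have hKy : y ∉ endpoints K := fun h => by simpa [hH'] using (hK3 y).1 h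
  rw [← pairProd_chordSign_eq_matchSign hκ' hK1 hK2 hK3,
    ← pairProd_chordSign_eq_matchSign (K := (x, y) :: K) hκ]
  · rw [pairProd]
    congr 1
    have e1 : (K.map (chordSign (ordSign κ) (x, y))).prod
        = ((endpoints K).map fun z => ordSign κ x z * ordSign κ y z).prod := by
      rw [prod_map_endpoints]
      congr 2
      funext k
      simp only [chordSign]
      ac_rfl
    have e2 : (endpoints K).Perm H'.toList := by
      rw [List.perm_ext_iff_of_nodup hK1 (Finset.nodup_toList _)]
      simpa using hK3
    rw [e1, (e2.map _).prod_eq, Finset.prod_map_toList]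
    have e3 : ∀ z ∈ H', ordSign κ x z * ordSign κ y z = if κ z < κ y then -1 else 1 := by
      intro z hz
      simp only [hH', Finset.mem_erase] at hz
      have hxz : κ x < κ z := lt_of_le_of_ne (hmin z hz.2.2)
        fun e => hz.2.1 (hκ hx hz.2.2 e).symm
      have hyz : κ y ≠ κ z := fun e => hz.1 (hκ hyH hz.2.2 e).symm
      rw [ordSign, if_pos hxz, one_mul, ordSign]
      rcases lt_or_gt_of_ne hyz with h | h
      · rw [if_pos h, if_neg h.not_gt]
      · rw [if_pos h, if_neg h.not_gt]
    rw [Finset.prod_congr rfl e3, Finset.prod_ite]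
    simp
  · rw [endpoints_cons, List.nodup_cons, List.nodup_cons]
    refine ⟨?_, hKy, hK1⟩
    rw [List.mem_cons]
    rintro (h | h)
    · exact hyx h.symm
    · exact hKx h
  · intro k hk
    rcases List.mem_cons.1 hk with rfl | hk
    · exact ⟨rfl, h1 x⟩
    · rw [hfg _ ((hK3 _).1 (mem_endpoints.2 ⟨k, hk, .inl rfl⟩)),
        hfg _ ((hK3 _).1 (mem_endpoints.2 ⟨k, hk, .inr rfl⟩))]
      exact hK2 k hk
  · intro z
    rw [endpoints_cons, List.mem_cons, List.mem_cons, hK3]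
    simp only [hH', Finset.mem_erase]
    constructor
    · rintro (rfl | rfl | h)
      exacts [hx, hyH, h.2.2]
    · tauto

open scoped Classical in
/-- The signed number of perfect matchings is `1`, provided that the blocks are intervals and have
an even number of elements. -/
theorem sum_matchSign [Fintype α] (κ : α → β) (blk : α → γ) (H : Finset α) (hκ : Set.InjOn κ H)
    (hblk : ∀ x ∈ H, ∀ y ∈ H, ∀ z ∈ H, κ x < κ y → κ y < κ z → blk z = blk x → blk y = blk x)
    (heven : ∀ b, Even (H.filter fun x => blk x = b).card) :
    ∑ f ∈ matchings H blk, ((matchSign κ H f : ℤˣ) : ℤ) = 1 := by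
  induction hn : H.card using Nat.strong_induction_on generalizing H with
  | _ n ih =>
  rcases H.eq_empty_or_nonempty with rfl | hne
  · have : matchings (∅ : Finset α) blk = {1} := by
      ext f
      rw [mem_matchings, Finset.mem_singleton]
      constructor
      · rintro ⟨-, h, -⟩
        ext x
        simpa using h x
      · rintro rfl
        simp
    rw [this, Finset.sum_singleton]
    simp [matchSign, leftEnds, pairProd]
  obtain ⟨x, hx, hmin⟩ := Finset.exists_min_image H κ hne
  set B := (H.filter fun y => blk y = blk x).erase x with hB
  have hmemB : ∀ y, y ∈ B ↔ y ≠ x ∧ y ∈ H ∧ blk y = blk x := by simp [hB]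
  have hodd : ¬ Even B.card := by
    have h1 := heven (blk x)
    rw [← Finset.card_erase_add_one (a := x) (by simp [hx]), ← hB, Nat.even_add_one] at h1
    exact h1
  have hmaps : ∀ f ∈ matchings H blk, f x ∈ B := fun f hf =>
    (hmemB _).2 ⟨apply_ne_of_mem_matchings hf hx, apply_mem_of_mem_matchings hf hx,
      (mem_matchings.1 hf).2.2 x⟩
  rw [← Finset.sum_fiberwise_of_maps_to hmaps]
  -- The partner `y` of the first point ranges over the rest `B` of its block. The induction reduces
  -- each fibre to the sign `(-1) ^ rank`, and the alternating sum over the odd set `B` is `1`.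
  rw [← (sum_neg_one_pow_rank κ B (hκ.mono fun y hy => ((hmemB y).1 hy).2.1)).trans (if_neg hodd)]
  refine Finset.sum_congr rfl fun y hy => ?_
  obtain ⟨hyx, hyH, hyb⟩ := (hmemB y).1 hy
  set H' := (H.erase x).erase y with hH'
  have hsub : H' ⊆ H := (Finset.erase_subset _ _).trans (Finset.erase_subset _ _)
  have hcard : H'.card < n := by
    rw [← hn]
    exact (Finset.card_erase_le).trans_lt (Finset.card_erase_lt_of_mem hx)
  have hIH := ih H'.card hcard H' (hκ.mono (Finset.coe_subset.2 hsub))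
    (fun a ha b hb c hc => hblk a (hsub ha) b (hsub hb) c (hsub hc))
    (by
      intro b
      have h0 := heven b
      by_cases hb : blk x = b
      · have e : H'.filter (fun z => blk z = b)
            = ((H.filter fun z => blk z = b).erase x).erase y := by
          rw [hH', Finset.filter_erase, Finset.filter_erase]
        rw [e]
        rw [← Finset.card_erase_add_one (a := x) (by simp [hx, hb]),
          ← Finset.card_erase_add_one (a := y) (by simp [hyx, hyH, hyb, hb]), add_assoc] at h0
        exact (Nat.even_add.1 h0).2 (by decide)
      · have e : H'.filter (fun z => blk z = b) = H.filter fun z => blk z = b := by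
          rw [hH', Finset.filter_erase, Finset.filter_erase, Finset.erase_eq_of_notMem,
            Finset.erase_eq_of_notMem]
          · simp [hb]
          · simp [hyb, hb]
        rwa [e]) rfl
  -- Blocks are intervals, so every point between `x` and `y` lies in their block; this makes the
  -- exponent a rank within `B`.
  have hrank : (H'.filter fun z => κ z < κ y).card = (B.filter fun z => κ z < κ y).card := by
    congr 1
    ext z
    simp only [Finset.mem_filter, hmemB, hH', Finset.mem_erase]
    constructor
    · rintro ⟨⟨hzy, hzx, hz⟩, hlt⟩
      refine ⟨⟨hzx, hz, hblk x hx z hz y hyH ?_ hlt hyb⟩, hlt⟩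
      exact lt_of_le_of_ne (hmin z hz) fun e => hzx (hκ hx hz e).symm
    · rintro ⟨⟨hzx, hz, -⟩, hlt⟩
      exact ⟨⟨by rintro rfl; exact lt_irrefl _ hlt, hzx, hz⟩, hlt⟩
  have hmul : (-1 : ℤ) ^ (H'.filter fun z => κ z < κ y).card
      = (-1) ^ (H'.filter fun z => κ z < κ y).card *
        ∑ f ∈ matchings H' blk, ((matchSign κ H' f : ℤˣ) : ℤ) := by rw [hIH, mul_one]
  rw [← hrank, hmul, Finset.mul_sum]
  refine Finset.sum_nbij' (fun f => f * Equiv.swap x y) (fun g => g * Equiv.swap x y) ?_ ?_ ?_ ?_ ?_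
  · intro f hf
    obtain ⟨hfm, hfy⟩ := Finset.mem_filter.1 hf
    have := mul_swap_mem_matchings hfm hx
    rwa [hfy] at this
  · intro g hg
    exact Finset.mem_filter.2 (mul_swap_mem_matchings_insert hx hyH hyx.symm hyb hg)
  · intro f _
    simp [mul_assoc]
  · intro f _
    simp [mul_assoc]
  · intro f hf
    obtain ⟨hfm, hfy⟩ := Finset.mem_filter.1 hf
    have h := matchSign_erase hκ hfm hx hmin
    rw [hfy, ← hH'] at h
    rw [h]
    simp only [Units.val_mul, Units.val_pow_eq_pow_val, Units.val_neg, Units.val_one]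

end Matchings

/-! ### Closed trails as periodic sequences, up to shift and reflection -/

section Cyclic

variable {V : Type*} {G : SimpleGraph V}

/-- The first `n` terms of a two-sided sequence. -/
def listOf (p : ℤ → V) (n : ℕ) : List V := (List.range n).map fun i : ℕ => p i

@[simp]
theorem length_listOf (p : ℤ → V) (n : ℕ) : (listOf p n).length = n := by simp [listOf]

@[simp]
theorem getElem_listOf (p : ℤ → V) (n : ℕ) (i : ℕ) (h : i < (listOf p n).length) :
    (listOf p n)[i] = p i := by simp [listOf]

theorem eq_of_dvd {p : ℤ → V} {n : ℕ} (hp : Function.Periodic p (n : ℤ)) {i j : ℤ}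
    (h : (n : ℤ) ∣ i - j) : p i = p j := by
  obtain ⟨k, hk⟩ := h
  have h1 := hp.int_mul k j
  have : i = j + k * n := by linarith
  rw [this]
  exact h1

theorem periodic_shift {p : ℤ → V} {n : ℕ} (hp : Function.Periodic p (n : ℤ)) (k : ℤ) :
    Function.Periodic (fun i => p (i + k)) (n : ℤ) := fun i => by
  change p _ = p _
  rw [add_right_comm, hp]

theorem periodic_reflect {p : ℤ → V} {n : ℕ} (hp : Function.Periodic p (n : ℤ)) (k : ℤ) :
    Function.Periodic (fun i => p (k - i)) (n : ℤ) := fun i => by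
  change p _ = p _
  exact eq_of_dvd hp ⟨-1, by ring⟩

theorem rotate_listOf {p : ℤ → V} {n : ℕ} (hp : Function.Periodic p (n : ℤ)) (k : ℕ) :
    (listOf p n).rotate k = listOf (fun i => p (i + k)) n := by
  apply List.ext_getElem
  · simp
  · intro i h1 h2
    rw [List.getElem_rotate]
    simp only [getElem_listOf, length_listOf]
    apply eq_of_dvd hp
    rw [Int.natCast_mod, Nat.cast_add]
    exact (Int.mod_modEq _ _).symm.dvd

theorem reverse_listOf {p : ℤ → V} {n : ℕ} (hp : Function.Periodic p (n : ℤ)) :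
    (listOf p n).reverse = listOf (fun i => p (-1 - i)) n := by
  apply List.ext_getElem
  · simp
  · intro i h1 h2
    rw [List.getElem_reverse]
    simp only [getElem_listOf, length_listOf] at h2 ⊢
    apply eq_of_dvd hp
    exact ⟨1, by omega⟩

theorem exists_eq_listOf {l : List V} (hl : 0 < l.length) :
    ∃ p : ℤ → V, Function.Periodic p (l.length : ℤ) ∧ l = listOf p l.length := by
  have hn : (0 : ℤ) < l.length := by exact_mod_cast hl
  refine ⟨fun i => l[(i % l.length).toNat]'(by
    have := Int.emod_lt_of_pos i hn
    have := Int.emod_nonneg i hn.ne'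
    omega), ?_, ?_⟩
  · intro i
    simp
  · apply List.ext_getElem
    · simp
    · intro i h1 h2
      rw [getElem_listOf]
      congr 1
      rw [← Int.natCast_mod, Int.toNat_natCast, Nat.mod_eq_of_lt h1]

theorem edgeList_listOf {p : ℤ → V} {n : ℕ} (hp : Function.Periodic p (n : ℤ)) :
    edgeList (listOf p n) = (List.range n).map fun i : ℕ => s(p i, p (i + 1)) := by
  rw [edgeList, rotate_listOf hp]
  apply List.ext_getElem
  · simp
  · intro i h1 h2
    simp

theorem isClosedPath_listOf {p : ℤ → V} {n : ℕ} (hp : Function.Periodic p (n : ℤ)) :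
    IsClosedPath G (listOf p n) ↔
      3 ≤ n ∧ ∀ i, G.Adj (p i) (p (i + 1)) ∧ p (i + 2) ≠ p i := by
  simp only [IsClosedPath, length_listOf]
  refine and_congr_right fun hn => ⟨fun h i => ?_, fun h k => ?_⟩
  · have hn0 : (0 : ℤ) < n := by omega
    have h0 := Int.emod_nonneg i hn0.ne'
    obtain ⟨k, hk⟩ := Int.eq_ofNat_of_zero_le h0
    have hd : (n : ℤ) ∣ i - k := by
      rw [← hk]
      exact Int.dvd_self_sub_emod
    have hpk : ∀ j : ℤ, p (i + j) = p (j + k) := fun j => eq_of_dvd hp (by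
      rwa [show i + j - (j + k) = i - k by ring])
    have h1 := h k
    rw [rotate_listOf hp] at h1
    have ha := List.isChain_iff_getElem.1 h1.1 0 (by simp; omega)
    have hb := h1.2 0 (by simp; omega)
    simp only [getElem_listOf] at ha hb
    have e0 := hpk 0
    have e1 := hpk 1
    have e2 := hpk 2
    rw [add_zero] at e0
    rw [e0, e1, e2]
    simpa using And.intro ha hb
  · rw [rotate_listOf hp]
    constructor
    · rw [List.isChain_iff_getElem]
      intro i hi
      simp only [getElem_listOf]
      have := (h (i + k)).1
      rwa [show (i : ℤ) + k + 1 = ((i + 1 : ℕ) : ℤ) + k by push_cast; ring] at this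
    · intro i hi
      simp only [getElem_listOf]
      have := (h (i + k)).2
      rwa [show (i : ℤ) + k + 2 = ((i + 2 : ℕ) : ℤ) + k by push_cast; ring] at this

theorem isEdgeDisjoint_listOf {p : ℤ → V} {n : ℕ} (hn : 0 < n)
    (hp : Function.Periodic p (n : ℤ)) :
    IsEdgeDisjoint (listOf p n) ↔
      ∀ i j, s(p i, p (i + 1)) = s(p j, p (j + 1)) → (n : ℤ) ∣ i - j := by
  have hn0 : (0 : ℤ) < n := by omega
  rw [IsEdgeDisjoint, edgeList_listOf hp, List.nodup_map_iff_inj_on List.nodup_range]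
  simp only [List.mem_range]
  constructor
  · intro h i j hij
    obtain ⟨a, ha⟩ := Int.eq_ofNat_of_zero_le (Int.emod_nonneg i hn0.ne')
    obtain ⟨b, hb⟩ := Int.eq_ofNat_of_zero_le (Int.emod_nonneg j hn0.ne')
    have hda : (n : ℤ) ∣ i - a := ha ▸ Int.dvd_self_sub_emod
    have hdb : (n : ℤ) ∣ j - b := hb ▸ Int.dvd_self_sub_emod
    have hpa : ∀ k : ℤ, p (i + k) = p (a + k) := fun k => eq_of_dvd hp (by
      rwa [show i + k - (a + k) = i - a by ring])
    have hpb : ∀ k : ℤ, p (j + k) = p (b + k) := fun k => eq_of_dvd hp (by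
      rwa [show j + k - (b + k) = j - b by ring])
    have ha0 := hpa 0
    have hb0 := hpb 0
    simp only [add_zero] at ha0 hb0
    rw [ha0, hpa, hb0, hpb] at hij
    have hlta := Int.emod_lt_of_pos i hn0
    have hltb := Int.emod_lt_of_pos j hn0
    have := h a (by omega) b (by omega) hij
    rw [this] at hda
    have := dvd_sub hda hdb
    rwa [show i - b - (j - b) = i - j by ring] at this
  · intro h i hi j hj hij
    have := Int.eq_zero_of_abs_lt_dvd (h i j hij) (by rw [abs_lt]; omega)
    omega

/-- A closed trail of length `n`, as a periodic sequence. -/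
structure IsCircuit (G : SimpleGraph V) (p : ℤ → V) (n : ℕ) : Prop where
  pos : 0 < n
  periodic : Function.Periodic p (n : ℤ)
  adj : ∀ i, G.Adj (p i) (p (i + 1))
  inj : ∀ i j, s(p i, p (i + 1)) = s(p j, p (j + 1)) → (n : ℤ) ∣ i - j

theorem IsCircuit.three_le {p : ℤ → V} {n : ℕ} (h : IsCircuit G p n) : 3 ≤ n := by
  have h0 := h.pos
  by_contra h3
  obtain rfl | rfl : n = 1 ∨ n = 2 := by omega
  · have h1 := h.periodic 0
    have h2 := h.adj 0
    simp only [Nat.cast_one, zero_add] at h1 h2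
    rw [h1] at h2
    exact G.irrefl h2
  · have h1 := h.periodic 0
    have h2 := h.inj 0 1
    simp only [Nat.cast_ofNat, zero_add] at h1 h2
    rw [show (1 : ℤ) + 1 = 2 by rfl, h1, Sym2.eq_swap] at h2
    exact absurd (h2 rfl) (by decide)

/-- Turning back would use the same edge in two consecutive steps. -/
theorem IsCircuit.ne {p : ℤ → V} {n : ℕ} (h : IsCircuit G p n) (i : ℤ) : p (i + 2) ≠ p i := by
  intro e
  have h2 := h.inj i (i + 1)
  rw [show i + 1 + 1 = i + 2 by ring, e] at h2
  have h3 := h2 Sym2.eq_swap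
  rw [show i - (i + 1) = -1 by ring, Int.dvd_neg] at h3
  have := Int.le_of_dvd one_pos h3
  have := h.three_le
  omega

theorem exists_isCircuit {l : List V} (h : IsClosedPath G l) (h' : IsEdgeDisjoint l) :
    ∃ p n, IsCircuit G p n ∧ l = listOf p n := by
  have hl : 0 < l.length := by have := h.1; omega
  obtain ⟨p, hp, e⟩ := exists_eq_listOf hl
  generalize l.length = n at *
  subst e
  exact ⟨p, n, ⟨hl, hp, fun i => (((isClosedPath_listOf hp).1 h).2 i).1,
    (isEdgeDisjoint_listOf hl hp).1 h'⟩, rfl⟩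

theorem IsCircuit.isClosedPath {p : ℤ → V} {n : ℕ} (h : IsCircuit G p n) :
    IsClosedPath G (listOf p n) :=
  (isClosedPath_listOf h.periodic).2 ⟨h.three_le, fun i => ⟨h.adj i, h.ne i⟩⟩

theorem IsCircuit.isEdgeDisjoint {p : ℤ → V} {n : ℕ} (h : IsCircuit G p n) :
    IsEdgeDisjoint (listOf p n) :=
  (isEdgeDisjoint_listOf h.pos h.periodic).2 h.inj

theorem mem_loopEdges_listOf {p : ℤ → V} {n : ℕ} (h : IsCircuit G p n) {e : Sym2 V} :
    e ∈ loopEdges (listOf p n) ↔ ∃ i, e = s(p i, p (i + 1)) := by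
  have hn0 : (0 : ℤ) < n := by exact_mod_cast h.pos
  classical
  rw [loopEdges, List.mem_toFinset, edgeList_listOf h.periodic, List.mem_map]
  constructor
  · rintro ⟨i, -, rfl⟩
    exact ⟨i, rfl⟩
  · rintro ⟨i, rfl⟩
    obtain ⟨a, ha⟩ := Int.eq_ofNat_of_zero_le (Int.emod_nonneg i hn0.ne')
    have hda : (n : ℤ) ∣ a - i := by
      rw [← ha, ← Int.dvd_neg, neg_sub]
      exact Int.dvd_self_sub_emod
    have hlta := Int.emod_lt_of_pos i hn0
    refine ⟨a, List.mem_range.2 (by omega), ?_⟩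
    rw [eq_of_dvd h.periodic hda, eq_of_dvd h.periodic (i := a + 1) (j := i + 1)]
    rwa [add_sub_add_right_eq_sub]

theorem IsCircuit.shift {p : ℤ → V} {n : ℕ} (h : IsCircuit G p n) (k : ℤ) :
    IsCircuit G (fun i => p (i + k)) n where
  pos := h.pos
  periodic := periodic_shift h.periodic k
  adj i := by
    have := h.adj (i + k)
    rwa [add_right_comm] at this
  inj i j hij := by
    have := h.inj (i + k) (j + k)
    rw [add_right_comm i, add_right_comm j, add_sub_add_right_eq_sub] at this
    exact this hij

theorem IsCircuit.reflect {p : ℤ → V} {n : ℕ} (h : IsCircuit G p n) (k : ℤ) :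
    IsCircuit G (fun i => p (k - i)) n where
  pos := h.pos
  periodic := periodic_reflect h.periodic k
  adj i := by
    have := h.adj (k - (i + 1))
    rw [show k - (i + 1) + 1 = k - i by ring] at this
    exact this.symm
  inj i j hij := by
    have := h.inj (k - (j + 1)) (k - (i + 1))
    rw [show k - (i + 1) + 1 = k - i by ring, show k - (j + 1) + 1 = k - j by ring,
      show k - (j + 1) - (k - (i + 1)) = i - j by ring] at this
    refine this ?_
    rw [Sym2.eq_swap, ← hij, Sym2.eq_swap]

/-- Two sequences that differ by a shift and possibly a reflection. -/
def IsVariant (p q : ℤ → V) : Prop :=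
  ∃ k : ℤ, (q = fun i => p (i + k)) ∨ q = fun i => p (k - i)

theorem IsVariant.refl (p : ℤ → V) : IsVariant p p := ⟨0, .inl (by simp)⟩

theorem IsVariant.symm {p q : ℤ → V} (h : IsVariant p q) : IsVariant q p := by
  obtain ⟨k, rfl | rfl⟩ := h
  · exact ⟨-k, .inl (by simp)⟩
  · exact ⟨k, .inr (by simp)⟩

theorem IsVariant.trans {p q r : ℤ → V} (h : IsVariant p q) (h' : IsVariant q r) :
    IsVariant p r := by
  obtain ⟨k, rfl | rfl⟩ := h <;> obtain ⟨j, rfl | rfl⟩ := h'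
  · exact ⟨j + k, .inl (by simp [add_assoc])⟩
  · exact ⟨j + k, .inr (by funext i; exact congrArg p (by ring))⟩
  · exact ⟨k - j, .inr (by funext i; exact congrArg p (by ring))⟩
  · exact ⟨k - j, .inl (by funext i; exact congrArg p (by ring))⟩

theorem IsCircuit.variant {p q : ℤ → V} {n : ℕ} (h : IsCircuit G p n) (hpq : IsVariant p q) :
    IsCircuit G q n := by
  obtain ⟨k, rfl | rfl⟩ := hpq
  · exact h.shift k
  · exact h.reflect k

theorem isRotated_listOf {p : ℤ → V} {n : ℕ} (hn : 0 < n) (hp : Function.Periodic p (n : ℤ))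
    {l : List V} : l ~r listOf p n ↔ ∃ k : ℤ, l = listOf (fun i => p (i + k)) n := by
  have hn0 : (0 : ℤ) < n := by exact_mod_cast hn
  constructor
  · intro h
    obtain ⟨k, rfl⟩ := h.symm
    exact ⟨k, rotate_listOf hp k⟩
  · rintro ⟨k, rfl⟩
    obtain ⟨a, ha⟩ := Int.eq_ofNat_of_zero_le (Int.emod_nonneg k hn0.ne')
    refine List.IsRotated.symm ⟨a, ?_⟩
    rw [rotate_listOf hp]
    congr 1
    funext i
    apply eq_of_dvd hp
    rw [show i + (a : ℤ) - (i + k) = -(k - a) by ring, Int.dvd_neg, ← ha]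
    exact Int.dvd_self_sub_emod

theorem isRotated_or_iff_isVariant {p : ℤ → V} {n : ℕ} (hn : 0 < n)
    (hp : Function.Periodic p (n : ℤ)) {l : List V} :
    (l ~r listOf p n ∨ l ~r (listOf p n).reverse) ↔ ∃ q, IsVariant p q ∧ l = listOf q n := by
  rw [reverse_listOf hp, isRotated_listOf hn hp, isRotated_listOf hn (periodic_reflect hp (-1))]
  constructor
  · rintro (⟨k, rfl⟩ | ⟨k, rfl⟩)
    · exact ⟨_, ⟨k, .inl rfl⟩, rfl⟩
    · exact ⟨_, ⟨-1 - k, .inr (by funext i; exact congrArg p (by ring))⟩, rfl⟩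
  · rintro ⟨_, ⟨k, rfl | rfl⟩, rfl⟩
    · exact .inl ⟨k, rfl⟩
    · exact .inr ⟨-1 - k, by congr 1; funext i; exact congrArg p (by ring)⟩

theorem eq_of_listOf_eq {p q : ℤ → V} {n : ℕ} (hn : 0 < n) (hp : Function.Periodic p (n : ℤ))
    (hq : Function.Periodic q (n : ℤ)) (h : listOf p n = listOf q n) : p = q := by
  have hn0 : (0 : ℤ) < n := by exact_mod_cast hn
  funext i
  obtain ⟨a, ha⟩ := Int.eq_ofNat_of_zero_le (Int.emod_nonneg i hn0.ne')
  have hda : (n : ℤ) ∣ i - a := ha ▸ Int.dvd_self_sub_emod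
  have hlta := Int.emod_lt_of_pos i hn0
  rw [eq_of_dvd hp hda, eq_of_dvd hq hda]
  have h1 : (listOf p n)[a]'(by simp; omega) = (listOf q n)[a]'(by simp; omega) := by
    simp only [h]
  simpa using h1

/-- A step of a circuit determines the circuit among its variants. -/
theorem IsCircuit.eq_of_variants {p q r : ℤ → V} {n : ℕ} (h : IsCircuit G p n)
    (hq : IsVariant p q) (hr : IsVariant p r) (h0 : q 0 = r 0) (h1 : q 1 = r 1) : q = r := by
  have hcq := h.variant hq
  obtain ⟨k, rfl | rfl⟩ := hq.symm.trans hr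
  · simp only [zero_add] at h0 h1
    have := hcq.inj 0 k
    rw [zero_add, add_comm k, ← h0, ← h1] at this
    funext i
    refine eq_of_dvd hcq.periodic ?_
    rw [show i - (i + k) = 0 - k by ring]
    exact this rfl
  · simp only [sub_zero] at h0 h1
    have := hcq.inj (k - 1) 0
    rw [zero_add, sub_add_cancel, ← h0, ← h1, Sym2.eq_swap] at this
    have h2 := eq_of_dvd hcq.periodic (this rfl)
    have h3 := hcq.adj 0
    rw [zero_add, ← h2, ← h1] at h3
    exact absurd h3 G.irrefl

end Cyclic

/-! ### Loops as canonical representatives of circuits -/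

section Loops

variable {V : Type*} {G : SimpleGraph V} (D : Drawing G)

theorem coords_injective : Function.Injective D.coords := by
  intro u v h
  apply D.pos_injective
  have h' : ((D.pos u).re, (D.pos u).im) = ((D.pos v).re, (D.pos v).im) := toLex.injective h
  rw [Prod.mk.injEq] at h'
  exact Complex.ext h'.1 h'.2

theorem isLoop_listOf_iff {p : ℤ → V} {n : ℕ} (h : IsCircuit G p n) :
    D.IsLoop (listOf p n) ↔
      ∀ q, IsVariant p q → (listOf p n).map D.coords ≤ (listOf q n).map D.coords := by
  rw [Drawing.IsLoop, and_iff_right h.isClosedPath]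
  constructor
  · intro hl q hq
    exact hl _ ((isRotated_or_iff_isVariant h.pos h.periodic).2 ⟨q, hq, rfl⟩)
  · intro hl l' hl'
    obtain ⟨q, hq, rfl⟩ := (isRotated_or_iff_isVariant h.pos h.periodic).1 hl'
    exact hl q hq

/-- Each circuit has a variant that is a loop. -/
theorem exists_isLoop_variant [Finite V] {p : ℤ → V} {n : ℕ} (h : IsCircuit G p n) :
    ∃ q, IsVariant p q ∧ D.IsLoop (listOf q n) := by
  have hfin : {l : List V | ∃ q, IsVariant p q ∧ l = listOf q n}.Finite := by
    refine (List.finite_length_eq V n).subset ?_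
    rintro _ ⟨q, -, rfl⟩
    simp
  obtain ⟨_, ⟨q, hq, rfl⟩, hmin⟩ := Set.exists_min_image _ (fun l => l.map D.coords) hfin
    ⟨_, p, IsVariant.refl p, rfl⟩
  refine ⟨q, hq, (isLoop_listOf_iff D (h.variant hq)).2 fun r hr => ?_⟩
  exact hmin _ ⟨r, hq.trans hr, rfl⟩

/-- Two loops that are variants of each other are equal. -/
theorem eq_of_isLoop_of_isVariant {p q : ℤ → V} {n : ℕ} (h : IsCircuit G p n)
    (hq : IsVariant p q) (hlp : D.IsLoop (listOf p n)) (hlq : D.IsLoop (listOf q n)) :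
    listOf p n = listOf q n := by
  have h1 := (isLoop_listOf_iff D h).1 hlp q hq
  have h2 := (isLoop_listOf_iff D (h.variant hq)).1 hlq p hq.symm
  exact (List.map_injective_iff.2 (coords_injective D)) (le_antisymm h1 h2)

end Loops

/-! ### Decompositions into loops and matchings of half-edges -/

section Transitions

variable {V : Type*} {G : SimpleGraph V}

/-- The sequence `p` leaves each of its vertices through the half-edge that `f` matches with the
half-edge through which it arrived. -/
def Follows (f : Equiv.Perm (V × V)) (p : ℤ → V) : Prop :=
  ∀ i, f (p i, p (i - 1)) = (p i, p (i + 1))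

theorem Follows.apply_next {f : Equiv.Perm (V × V)} (hf : ∀ x, f (f x) = x) {p : ℤ → V}
    (h : Follows f p) (i : ℤ) : f (p i, p (i + 1)) = (p i, p (i - 1)) := by
  rw [← h i, hf]

theorem Follows.variant {f : Equiv.Perm (V × V)} (hf : ∀ x, f (f x) = x) {p q : ℤ → V}
    (h : Follows f p) (hpq : IsVariant p q) : Follows f q := by
  obtain ⟨k, rfl | rfl⟩ := hpq
  · intro i
    have := h (i + k)
    rw [show i + k - 1 = i - 1 + k by ring, show i + k + 1 = i + 1 + k by ring] at this
    exact this
  · intro i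
    have := h.apply_next hf (k - i)
    rw [show k - i - 1 = k - (i + 1) by ring, show k - i + 1 = k - (i - 1) by ring] at this
    exact this

theorem Follows.ext {f : Equiv.Perm (V × V)} (hf : ∀ x, f (f x) = x) {p q : ℤ → V}
    (hp : Follows f p) (hq : Follows f q) (h0 : p 0 = q 0) (h1 : p 1 = q 1) : p = q := by
  have key : ∀ i : ℤ, p i = q i ∧ p (i + 1) = q (i + 1) := by
    intro i
    induction i using Int.induction_on with
    | zero => exact ⟨h0, by simpa using h1⟩
    | succ k ih =>
      refine ⟨ih.2, ?_⟩
      have e1 := hp (k + 1)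
      have e2 := hq (k + 1)
      rw [add_sub_cancel_right] at e1 e2
      rw [ih.1, ih.2, e2] at e1
      exact (congrArg Prod.snd e1).symm
    | pred k ih =>
      rw [sub_add_cancel]
      refine ⟨?_, ih.1⟩
      have e1 := hp.apply_next hf (-k)
      have e2 := hq.apply_next hf (-k)
      rw [ih.1, ih.2, e2] at e1
      exact (congrArg Prod.snd e1).symm
  exact funext fun i => (key i).1

theorem exists_variant_of_step {p : ℤ → V} {u v : V} {i : ℤ} (h : s(u, v) = s(p i, p (i + 1))) :
    ∃ q, IsVariant p q ∧ q 0 = u ∧ q 1 = v := by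
  rcases Sym2.eq_iff.1 h with ⟨rfl, rfl⟩ | ⟨rfl, rfl⟩
  · exact ⟨_, ⟨i, .inl rfl⟩, by simp, by simp [add_comm]⟩
  · exact ⟨_, ⟨i + 1, .inr rfl⟩, by simp, by simp⟩

/-- Shifts and reflections bring the common edge to the first step of both sequences, and `f` then
determines them in both directions. Edge-disjointness forces each length to divide the other, so the
two loops are variants of one circuit and hence equal. -/
theorem Follows.eq_of_common_edge (D : Drawing G) {f : Equiv.Perm (V × V)}
    (hf : ∀ x, f (f x) = x) {p q : ℤ → V} {n m : ℕ} (hp : IsCircuit G p n) (hq : IsCircuit G q m)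
    (hlp : D.IsLoop (listOf p n)) (hlq : D.IsLoop (listOf q m)) (hfp : Follows f p)
    (hfq : Follows f q) {i j : ℤ} (h : s(p i, p (i + 1)) = s(q j, q (j + 1))) :
    listOf p n = listOf q m := by
  obtain ⟨p', hpp', hp0, hp1⟩ := exists_variant_of_step (p := p) (i := i) rfl
  obtain ⟨q', hqq', hq0, hq1⟩ := exists_variant_of_step h
  obtain rfl := (hfp.variant hf hpp').ext hf (hfq.variant hf hqq') (hp0.trans hq0.symm)
    (hp1.trans hq1.symm)
  have hp' := hp.variant hpp'
  have hq' := hq.variant hqq'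
  have hnm : n = m := by
    have h1 := hp'.inj 0 (0 + m)
    rw [hq'.periodic 0, add_right_comm, hq'.periodic] at h1
    have h2 := hq'.inj 0 (0 + n)
    rw [hp'.periodic 0, add_right_comm, hp'.periodic] at h2
    have h1 := h1 rfl
    have h2 := h2 rfl
    rw [zero_add, zero_sub, Int.dvd_neg, Int.natCast_dvd_natCast] at h1 h2
    exact Nat.dvd_antisymm h1 h2
  subst hnm
  exact eq_of_isLoop_of_isVariant D hp (hpp'.trans hqq'.symm) hlp hlq

variable [Fintype V]

open scoped Classical in
/-- The pairs `(v, w)` such that `vw ∈ F`, which represent the half-edges of `F`. -/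
noncomputable def halfEdges (F : Finset (Sym2 V)) : Finset (V × V) :=
  Finset.univ.filter fun x => s(x.1, x.2) ∈ F

theorem mem_halfEdges {F : Finset (Sym2 V)} {x : V × V} :
    x ∈ halfEdges F ↔ s(x.1, x.2) ∈ F := by
  simp [halfEdges]

theorem swap_mem_halfEdges {F : Finset (Sym2 V)} {x : V × V} :
    x.swap ∈ halfEdges F ↔ x ∈ halfEdges F := by
  rw [mem_halfEdges, mem_halfEdges, Prod.fst_swap, Prod.snd_swap, Sym2.eq_swap]

variable (D : Drawing G)

theorem mem_edgeDisjointLoops {l : List V} :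
    l ∈ D.edgeDisjointLoops ↔ D.IsLoop l ∧ IsEdgeDisjoint l := by
  simp [Drawing.edgeDisjointLoops]

theorem mem_edgeDisjointCollections {S : Finset (List V)} :
    S ∈ D.edgeDisjointCollections ↔ (∀ l ∈ S, D.IsLoop l ∧ IsEdgeDisjoint l) ∧
      ∀ l ∈ S, ∀ l' ∈ S, l ≠ l' → Disjoint (loopEdges l) (loopEdges l') := by
  simp only [Drawing.edgeDisjointCollections, Finset.mem_filter, Finset.mem_powerset,
    Finset.subset_iff, mem_edgeDisjointLoops]

theorem mem_decompositions {F : Finset (Sym2 V)} {S : Finset (List V)} :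
    S ∈ D.decompositions F ↔ S ∈ D.edgeDisjointCollections ∧
      ∀ e, e ∈ F ↔ ∃ l ∈ S, e ∈ loopEdges l := by
  classical
  rw [Drawing.decompositions, Finset.mem_filter]
  refine and_congr_right fun _ => ?_
  rw [Finset.ext_iff]
  simp only [Finset.mem_biUnion]
  exact forall_congr' fun e => iff_comm

/-- All loops of `S` follow `f`. -/
def CollectionFollows (f : Equiv.Perm (V × V)) (S : Finset (List V)) : Prop :=
  ∀ l ∈ S, ∃ p n, IsCircuit G p n ∧ l = listOf p n ∧ Follows f p

theorem exists_isCircuit_of_mem {S : Finset (List V)} (hS : S ∈ D.edgeDisjointCollections)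
    {l : List V} (hl : l ∈ S) : ∃ p n, IsCircuit G p n ∧ l = listOf p n :=
  have h := ((mem_edgeDisjointCollections D).1 hS).1 l hl
  exists_isCircuit h.1.1 h.2

theorem eq_of_common_edge_of_mem {S : Finset (List V)} (hS : S ∈ D.edgeDisjointCollections)
    {l l' : List V} (hl : l ∈ S) (hl' : l' ∈ S) {e : Sym2 V} (he : e ∈ loopEdges l)
    (he' : e ∈ loopEdges l') : l = l' := by
  by_contra hne
  exact Finset.disjoint_left.1 (((mem_edgeDisjointCollections D).1 hS).2 l hl l' hl' hne) he he'

theorem mem_halfEdges_of_follows {F : Finset (Sym2 V)} {f : Equiv.Perm (V × V)}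
    (hf : f ∈ matchings (halfEdges F) Prod.fst) {p : ℤ → V} {n : ℕ} (hp : IsCircuit G p n)
    (h : Follows f p) (i : ℤ) : (p i, p (i - 1)) ∈ halfEdges F := by
  by_contra hx
  have h1 := ((mem_matchings.1 hf).2.1 _).2 hx
  rw [h i, Prod.mk.injEq] at h1
  have := hp.ne (i - 1)
  rw [show i - 1 + 2 = i + 1 by ring] at this
  exact this h1.2

/-- A collection of loops that covers `F` is determined by its transitions. -/
theorem subset_of_collectionFollows {F : Finset (Sym2 V)} {f : Equiv.Perm (V × V)}
    (hf : ∀ x, f (f x) = x) {S T : Finset (List V)} (hS : S ∈ D.decompositions F)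
    (hT : T ∈ D.decompositions F) (hfS : CollectionFollows (G := G) f S)
    (hfT : CollectionFollows (G := G) f T) : S ⊆ T := by
  intro l hl
  rw [mem_decompositions] at hS hT
  have hloop := ((mem_edgeDisjointCollections D).1 hS.1).1 l hl
  obtain ⟨p, n, hp, rfl, hfp⟩ := hfS l hl
  have he : s(p 0, p (0 + 1)) ∈ F := (hS.2 _).2 ⟨_, hl, (mem_loopEdges_listOf hp).2 ⟨0, rfl⟩⟩
  obtain ⟨l', hl', he'⟩ := (hT.2 _).1 he
  have hloop' := ((mem_edgeDisjointCollections D).1 hT.1).1 l' hl'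
  obtain ⟨q, m, hq, rfl, hfq⟩ := hfT l' hl'
  obtain ⟨j, hj⟩ := (mem_loopEdges_listOf hq).1 he'
  rwa [hfp.eq_of_common_edge D hf hp hq hloop.1 hloop'.1 hfq hj]

/-- The transitions are determined by a collection of loops that covers `F`. -/
theorem eq_of_collectionFollows {F : Finset (Sym2 V)} {f g : Equiv.Perm (V × V)}
    (hf : f ∈ matchings (halfEdges F) Prod.fst) (hg : g ∈ matchings (halfEdges F) Prod.fst)
    {S : Finset (List V)} (hS : S ∈ D.decompositions F)
    (hfS : CollectionFollows (G := G) f S) (hgS : CollectionFollows (G := G) g S) : f = g := by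
  obtain ⟨hf1, hf2, -⟩ := mem_matchings.1 hf
  obtain ⟨hg1, hg2, -⟩ := mem_matchings.1 hg
  ext1 x
  by_cases hx : x ∈ halfEdges F
  · rw [mem_decompositions] at hS
    obtain ⟨l, hl, he⟩ := (hS.2 _).1 (mem_halfEdges.1 hx)
    obtain ⟨p, n, hp, rfl, hfp⟩ := hfS l hl
    obtain ⟨q, m, hq, hpq, hgq⟩ := hgS _ hl
    have hnm : n = m := by simpa using congrArg List.length hpq
    subst hnm
    obtain rfl := eq_of_listOf_eq hp.pos hp.periodic hq.periodic hpq
    obtain ⟨i, hi⟩ := (mem_loopEdges_listOf hp).1 he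
    obtain ⟨r, hpr, hr0, hr1⟩ := exists_variant_of_step hi
    have h1 := (hfp.variant hf1 hpr).apply_next hf1 0
    have h2 := (hgq.variant hg1 hpr).apply_next hg1 0
    rw [zero_add, hr0, hr1] at h1 h2
    exact h1.trans h2.symm
  · rw [(hf2 x).2 hx, (hg2 x).2 hx]

/-- The transitions of a collection of loops form a matching of the half-edges. -/
theorem exists_matching {F : Finset (Sym2 V)} {S : Finset (List V)} (hS : S ∈ D.decompositions F) :
    ∃ f ∈ matchings (halfEdges F) Prod.fst, CollectionFollows (G := G) f S := by
  classical
  rw [mem_decompositions] at hS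
  -- `x` and `y` are the two half-edges of one passage of a loop through a vertex. Variants include
  -- reflections, which makes the relation symmetric.
  let R : V × V → V × V → Prop := fun x y =>
    ∃ p n, IsCircuit G p n ∧ listOf p n ∈ S ∧ ∃ q, IsVariant p q ∧ x = (q 0, q 1) ∧
      y = (q 0, q (-1))
  have htotal : ∀ x, ∃ y, x ∈ halfEdges F → R x y := by
    intro x
    by_cases hx : x ∈ halfEdges F
    · obtain ⟨l, hl, he⟩ := (hS.2 _).1 (mem_halfEdges.1 hx)
      obtain ⟨p, n, hp, rfl⟩ := exists_isCircuit_of_mem D hS.1 hl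
      obtain ⟨i, hi⟩ := (mem_loopEdges_listOf hp).1 he
      obtain ⟨q, hpq, hq0, hq1⟩ := exists_variant_of_step hi
      exact ⟨_, fun _ => ⟨p, n, hp, hl, q, hpq, by rw [hq0, hq1], rfl⟩⟩
    · exact ⟨x, fun h => absurd h hx⟩
  have hmem : ∀ {p : ℤ → V} {n : ℕ}, IsCircuit G p n → listOf p n ∈ S → ∀ {q : ℤ → V},
      IsVariant p q → ∀ i, s(q i, q (i + 1)) ∈ loopEdges (listOf p n) := by
    intro p n hp hl q hpq i
    rw [mem_loopEdges_listOf hp]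
    obtain ⟨k, rfl | rfl⟩ := hpq
    · exact ⟨i + k, by rw [add_right_comm]⟩
    · refine ⟨k - (i + 1), ?_⟩
      rw [Sym2.eq_swap, show k - (i + 1) + 1 = k - i by ring]
  have hfun : ∀ {x y z}, R x y → R x z → y = z := by
    rintro x y z ⟨p, n, hp, hl, q, hpq, rfl, rfl⟩ ⟨p', n', hp', hl', q', hpq', hx, rfl⟩
    rw [Prod.mk.injEq] at hx
    have e1 := hmem hp hl hpq 0
    have e2 := hmem hp' hl' hpq' 0
    rw [zero_add] at e1 e2
    rw [← hx.1, ← hx.2] at e2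
    have e3 := eq_of_common_edge_of_mem D hS.1 hl hl' e1 e2
    have hnm : n = n' := by simpa using congrArg List.length e3
    subst hnm
    obtain rfl := eq_of_listOf_eq hp.pos hp.periodic hp'.periodic e3
    rw [hp.eq_of_variants hpq hpq' hx.1 hx.2]
  have hsymm : ∀ {x y}, R x y → R y x := by
    rintro x y ⟨p, n, hp, hl, q, hpq, rfl, rfl⟩
    exact ⟨p, n, hp, hl, fun i => q (0 - i), hpq.trans ⟨0, .inr rfl⟩, by simp, by simp⟩
  have hR : ∀ {x y}, R x y → y ∈ halfEdges F ∧ y.1 = x.1 ∧ y ≠ x := by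
    rintro x y ⟨p, n, hp, hl, q, hpq, rfl, rfl⟩
    refine ⟨?_, rfl, ?_⟩
    · rw [mem_halfEdges, hS.2, Sym2.eq_swap]
      refine ⟨_, hl, ?_⟩
      simpa using hmem hp hl hpq (-1)
    · intro e
      have := (hp.variant hpq).ne (-1)
      rw [show (-1 : ℤ) + 2 = 1 by rfl] at this
      exact this (congrArg Prod.snd e).symm
  choose g hg using htotal
  let f : V × V → V × V := fun x => if x ∈ halfEdges F then g x else x
  have hfH : ∀ x ∈ halfEdges F, R x (f x) := fun x hx => by
    simp only [f, if_pos hx]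
    exact hg x hx
  have hfn : ∀ x, x ∉ halfEdges F → f x = x := fun x hx => by simp only [f, if_neg hx]
  have hinv : Function.Involutive f := by
    intro x
    by_cases hx : x ∈ halfEdges F
    · have h1 := hfH x hx
      exact hfun (hfH _ (hR h1).1) (hsymm h1)
    · rw [hfn x hx, hfn x hx]
  refine ⟨hinv.toPerm f, mem_matchings.2 ⟨hinv, fun x => ⟨fun h hx => ?_, hfn x⟩, fun x => ?_⟩, ?_⟩
  · exact (hR (hfH x hx)).2.2 h
  · by_cases hx : x ∈ halfEdges F
    · exact (hR (hfH x hx)).2.1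
    · exact congrArg Prod.fst (hfn x hx)
  · intro l hl
    obtain ⟨p, n, hp, rfl⟩ := exists_isCircuit_of_mem D hS.1 hl
    refine ⟨p, n, hp, rfl, fun i => ?_⟩
    have h1 : R (p i, p (i - 1)) (p i, p (i + 1)) :=
      ⟨p, n, hp, hl, fun j => p (i - j), ⟨i, .inr rfl⟩, by simp, by simp⟩
    exact hfun (hfH _ (hR (hsymm h1)).1) h1

/-- Through each half-edge of `F` passes a circuit that follows a given matching. -/
theorem exists_circuit_follows {F : Finset (Sym2 V)} (hF : ∀ u v, s(u, v) ∈ F → G.Adj u v)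
    {f : Equiv.Perm (V × V)} (hf : f ∈ matchings (halfEdges F) Prod.fst) {x : V × V}
    (hx : x ∈ halfEdges F) :
    ∃ p n, IsCircuit G p n ∧ Follows f p ∧ p 0 = x.1 ∧ p 1 = x.2 := by
  classical
  obtain ⟨h1, h2, h3⟩ := mem_matchings.1 hf
  let w : Equiv.Perm (V × V) := Equiv.prodComm V V
  have hw : ∀ y, w y = y.swap := fun y => rfl
  have hww : w * w = 1 := by ext1 y; simp [hw]
  have hff : f * f = 1 := by ext1 y; simp [h1]
  -- One step of the walk: cross the edge to its far half-edge, then pass to the partner there. The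
  -- circuit is the orbit of `x`.
  set ρ : Equiv.Perm (V × V) := f * w with hρ
  have hρ1 : ∀ y, (ρ y).1 = y.2 := fun y => by
    rw [hρ, Equiv.Perm.mul_apply, h3, hw, Prod.fst_swap]
  have hρinv : ρ⁻¹ = w * f := by
    rw [hρ, mul_inv_rev, inv_eq_of_mul_eq_one_left hww, inv_eq_of_mul_eq_one_left hff]
  -- Reversing the direction of travel inverts the walk, as `ρ` is a product of two involutions.
  have hconj : ∀ k : ℤ, w * ρ ^ k = ρ ^ (-k) * w := by
    intro k
    have e1 : w * ρ * w⁻¹ = ρ⁻¹ := by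
      rw [hρinv, hρ, ← mul_assoc, mul_assoc, mul_inv_cancel, mul_one]
    have e2 := conj_zpow (i := k) (a := w) (b := ρ)
    rw [e1, inv_zpow'] at e2
    rw [e2, inv_mul_cancel_right]
  have hmem : ∀ k : ℤ, (ρ ^ k) x ∈ halfEdges F := by
    intro k
    induction k using Int.induction_on with
    | zero => simpa using hx
    | succ k ih =>
      rw [add_comm, zpow_one_add, Equiv.Perm.mul_apply, hρ, Equiv.Perm.mul_apply, hw]
      exact apply_mem_of_mem_matchings hf (swap_mem_halfEdges.2 ih)
    | pred k ih =>
      rw [sub_eq_neg_add, zpow_add, zpow_neg_one, Equiv.Perm.mul_apply, hρinv,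
        Equiv.Perm.mul_apply, hw]
      exact swap_mem_halfEdges.2 (apply_mem_of_mem_matchings hf ih)
  let p : ℤ → V := fun i => ((ρ ^ i) x).1
  have hstep : ∀ i, (ρ ^ i) x = (p i, p (i + 1)) := by
    intro i
    have : p (i + 1) = ((ρ ^ i) x).2 := by
      change ((ρ ^ (i + 1)) x).1 = _
      rw [add_comm, zpow_one_add, Equiv.Perm.mul_apply, hρ1]
    rw [this]
  have hadj : ∀ i, G.Adj (p i) (p (i + 1)) := fun i => by
    have := hmem i
    rw [hstep, mem_halfEdges] at this
    exact hF _ _ this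
  -- The walk never uses its first edge backwards. Otherwise, going half of the `k` steps would
  -- reach a step equal to its own reversal (`k` even) or a half-edge matched with itself (`k` odd).
  have hne : ∀ k : ℤ, (ρ ^ k) x ≠ w x := by
    intro k hk
    rcases Int.even_or_odd' k with ⟨m, rfl | rfl⟩
    · have e : (ρ ^ m) x = w ((ρ ^ m) x) := by
        rw [← Equiv.Perm.mul_apply, hconj, Equiv.Perm.mul_apply, ← hk, ← Equiv.Perm.mul_apply,
          ← zpow_add]
        congr 2
        ring
      rw [hw, hstep] at e
      have := hadj m
      rw [(Prod.mk.inj e).1] at this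
      exact G.irrefl this
    · have e : ρ ((ρ ^ m) x) = w ((ρ ^ m) x) := by
        rw [← Equiv.Perm.mul_apply w, hconj, Equiv.Perm.mul_apply (ρ ^ (-m)) w, ← hk,
          ← Equiv.Perm.mul_apply, ← zpow_one_add, ← Equiv.Perm.mul_apply, ← zpow_add]
        congr 2
        ring
      rw [hρ, Equiv.Perm.mul_apply] at e
      exact apply_ne_of_mem_matchings hf (swap_mem_halfEdges.2 (hmem m)) e
  refine ⟨p, MulAction.period ρ x, ⟨?_, ?_, hadj, ?_⟩, ?_, ?_, ?_⟩
  · exact MulAction.period_pos_of_orderOf_pos (orderOf_pos ρ) x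
  · intro i
    change ((ρ ^ _) x).1 = ((ρ ^ _) x).1
    have : (ρ ^ ((MulAction.period ρ x : ℕ) : ℤ)) • x = x :=
      MulAction.zpow_smul_eq_iff_period_dvd.2 dvd_rfl
    rw [zpow_add, Equiv.Perm.mul_apply]
    rw [Equiv.Perm.smul_def] at this
    rw [this]
  · intro i j hij
    rw [← MulAction.zpow_smul_eq_iff_period_dvd, Equiv.Perm.smul_def]
    rcases Sym2.eq_iff.1 hij with ⟨e1, e2⟩ | ⟨e1, e2⟩
    · have e : (ρ ^ i) x = (ρ ^ j) x := by rw [hstep, hstep, e1, e2]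
      rw [sub_eq_neg_add, zpow_add, Equiv.Perm.mul_apply, e, ← Equiv.Perm.mul_apply, ← zpow_add,
        neg_add_cancel, zpow_zero, Equiv.Perm.one_apply]
    · exfalso
      have e : (ρ ^ i) x = w ((ρ ^ j) x) := by rw [hstep, hstep, e1, e2]; rfl
      apply hne (j + i)
      rw [zpow_add, Equiv.Perm.mul_apply, e, ← Equiv.Perm.mul_apply w, hconj,
        ← Equiv.Perm.mul_apply, ← mul_assoc, ← zpow_add, add_neg_cancel, zpow_zero, one_mul]
  · intro i
    have e1 := hstep (i - 1)
    rw [sub_add_cancel] at e1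
    have e2 : ρ ((ρ ^ (i - 1)) x) = (ρ ^ i) x := by
      rw [← Equiv.Perm.mul_apply, ← zpow_one_add, add_sub_cancel]
    rw [e1, hstep, hρ, Equiv.Perm.mul_apply] at e2
    exact e2
  · simp [p]
  · change ((ρ ^ (1 : ℤ)) x).1 = _
    rw [zpow_one, hρ1]

/-- All edge-disjoint loops that follow `f` form the collection: they are disjoint by
`Follows.eq_of_common_edge`, and they cover `F` because the circuit through a given half-edge has a
variant that is a loop. -/
theorem exists_decomposition {F : Finset (Sym2 V)} (hF : ∀ u v, s(u, v) ∈ F → G.Adj u v)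
    {f : Equiv.Perm (V × V)} (hf : f ∈ matchings (halfEdges F) Prod.fst) :
    ∃ S ∈ D.decompositions F, CollectionFollows (G := G) f S := by
  classical
  have hff := (mem_matchings.1 hf).1
  refine ⟨D.edgeDisjointLoops.filter fun l => ∃ p n, IsCircuit G p n ∧ l = listOf p n ∧
    Follows f p, ?_, fun l hl => (Finset.mem_filter.1 hl).2⟩
  rw [mem_decompositions, mem_edgeDisjointCollections]
  refine ⟨⟨fun l hl => (mem_edgeDisjointLoops D).1 (Finset.mem_filter.1 hl).1, ?_⟩, ?_⟩
  · intro l hl l' hl' hne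
    rw [Finset.disjoint_left]
    intro e he he'
    obtain ⟨hl, p, n, hp, rfl, hfp⟩ := Finset.mem_filter.1 hl
    obtain ⟨hl', q, m, hq, rfl, hfq⟩ := Finset.mem_filter.1 hl'
    obtain ⟨i, rfl⟩ := (mem_loopEdges_listOf hp).1 he
    obtain ⟨j, hj⟩ := (mem_loopEdges_listOf hq).1 he'
    exact hne (hfp.eq_of_common_edge D hff hp hq ((mem_edgeDisjointLoops D).1 hl).1
      ((mem_edgeDisjointLoops D).1 hl').1 hfq hj)
  · intro e
    constructor
    · induction e with | _ u v => ?_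
      intro he
      obtain ⟨p, n, hp, hfp, hp0, hp1⟩ := exists_circuit_follows hF hf (x := (u, v))
        (mem_halfEdges.2 he)
      obtain ⟨q, hpq, hq⟩ := exists_isLoop_variant D hp
      have hcq := hp.variant hpq
      refine ⟨listOf q n, Finset.mem_filter.2 ⟨(mem_edgeDisjointLoops D).2
        ⟨hq, hcq.isEdgeDisjoint⟩, q, n, hcq, rfl, hfp.variant hff hpq⟩, ?_⟩
      rw [mem_loopEdges_listOf hcq, ← show p 0 = u from hp0, ← show p 1 = v from hp1]
      obtain ⟨k, rfl | rfl⟩ := hpq.symm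
      · exact ⟨k, by simp [add_comm]⟩
      · exact ⟨k - 1, by simp [Sym2.eq_swap]⟩
    · rintro ⟨l, hl, he⟩
      obtain ⟨-, p, n, hp, rfl, hfp⟩ := Finset.mem_filter.1 hl
      obtain ⟨i, rfl⟩ := (mem_loopEdges_listOf hp).1 he
      have := mem_halfEdges.1 (mem_halfEdges_of_follows hf hp hfp (i + 1))
      rw [add_sub_cancel_right] at this
      rwa [Sym2.eq_swap]

/-- Summation over decompositions as summation over matchings of half-edges. -/
theorem sum_decompositions_eq {F : Finset (Sym2 V)} (hF : ∀ u v, s(u, v) ∈ F → G.Adj u v)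
    (φ : Finset (List V) → ℂ) (ψ : Equiv.Perm (V × V) → ℂ)
    (h : ∀ S ∈ D.decompositions F, ∀ f ∈ matchings (halfEdges F) Prod.fst,
      CollectionFollows (G := G) f S → φ S = ψ f) :
    ∑ S ∈ D.decompositions F, φ S = ∑ f ∈ matchings (halfEdges F) Prod.fst, ψ f := by
  choose i hi hiS using fun S (hS : S ∈ D.decompositions F) => exists_matching D hS
  refine Finset.sum_bij i hi ?_ ?_ fun S hS => h S hS _ (hi S hS) (hiS S hS)
  · intro S hS T hT e
    have hff := (mem_matchings.1 (hi S hS)).1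
    have hT' := hiS T hT
    rw [← e] at hT'
    exact (subset_of_collectionFollows D hff hS hT (hiS S hS) hT').antisymm
      (subset_of_collectionFollows D hff hT hS hT' (hiS S hS))
  · intro f hf
    obtain ⟨S, hS, hfS⟩ := exists_decomposition D hF hf
    exact ⟨S, hS, eq_of_collectionFollows D (hi S hS) hf hS (hiS S hS) hfS⟩

end Transitions

/-! ### Plane geometry in the lexicographic order: segments, determinants, arguments -/

section Plane

/-- The upper half of the plane without the origin, in the lexicographic order. -/
def IsUp (z : ℂ) : Prop := 0 < z.re ∨ z.re = 0 ∧ 0 < z.im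

theorem isUp_or_isUp_neg {z : ℂ} (hz : z ≠ 0) : IsUp z ∨ IsUp (-z) := by
  by_contra! h
  simp only [IsUp, Complex.neg_re, Complex.neg_im, not_or, not_and, not_lt] at h
  obtain ⟨⟨h1, h2⟩, h3, h4⟩ := h
  have hre : z.re = 0 := by linarith
  have := h2 hre
  have := h4 (by linarith)
  exact hz (Complex.ext hre (by simp only [Complex.zero_im]; linarith))

theorem IsUp.not_neg {z : ℂ} (h : IsUp z) : ¬ IsUp (-z) := by
  simp only [IsUp, Complex.neg_re, Complex.neg_im]
  rintro (h' | ⟨h1, h2⟩) <;> rcases h with h | ⟨h3, h4⟩ <;> linarith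

theorem IsUp.ne_zero {z : ℂ} (h : IsUp z) : z ≠ 0 := by
  rintro rfl
  simp [IsUp] at h

theorem IsUp.add {z w : ℂ} (h : IsUp z) (h' : IsUp w) : IsUp (z + w) := by
  simp only [IsUp, Complex.add_re, Complex.add_im]
  rcases h with h | ⟨h1, h2⟩ <;> rcases h' with h' | ⟨h3, h4⟩
  · exact .inl (by linarith)
  · exact .inl (by linarith)
  · exact .inl (by linarith)
  · exact .inr ⟨by linarith, by linarith⟩

theorem IsUp.smul {z : ℂ} (h : IsUp z) {r : ℝ} (hr : 0 < r) : IsUp (r • z) := by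
  simp only [IsUp, Complex.smul_re, Complex.smul_im, smul_eq_mul]
  rcases h with h | ⟨h1, h2⟩
  · exact .inl (mul_pos hr h)
  · exact .inr ⟨by rw [h1, mul_zero], mul_pos hr h2⟩

theorem IsUp.pos_of_smul {z : ℂ} (h : IsUp z) {r : ℝ} (hr : IsUp (r • z)) : 0 < r := by
  rcases lt_trichotomy r 0 with h0 | rfl | h0
  · have := h.smul (neg_pos.2 h0)
    rw [neg_smul] at this
    exact absurd this hr.not_neg
  · rw [zero_smul] at hr
    exact absurd rfl hr.ne_zero
  · exact h0

/-- The determinant of two vectors of the plane. -/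
def cr (z w : ℂ) : ℝ := z.re * w.im - z.im * w.re

theorem exists_smul_of_cr_eq_zero {z w : ℂ} (hz : z ≠ 0) (h : cr z w = 0) : ∃ r : ℝ, w = r • z := by
  have hn : z.re * z.re + z.im * z.im ≠ 0 := by
    intro h0
    apply hz
    apply Complex.ext
    · simp only [Complex.zero_re]; nlinarith
    · simp only [Complex.zero_im]; nlinarith
  unfold cr at h
  refine ⟨(w.re * z.re + w.im * z.im) / (z.re * z.re + z.im * z.im), ?_⟩
  apply Complex.ext
  · simp only [Complex.smul_re, smul_eq_mul]
    rw [div_mul_eq_mul_div, eq_div_iff hn]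
    linear_combination -z.im * h
  · simp only [Complex.smul_im, smul_eq_mul]
    rw [div_mul_eq_mul_div, eq_div_iff hn]
    linear_combination z.re * h

theorem mem_segment_iff {a b p : ℂ} :
    p ∈ segment ℝ a b ↔ ∃ t : ℝ, 0 ≤ t ∧ t ≤ 1 ∧ p = a + t • (b - a) := by
  rw [segment_eq_image']
  constructor
  · rintro ⟨t, ⟨h0, h1⟩, rfl⟩
    exact ⟨t, h0, h1, rfl⟩
  · rintro ⟨t, h0, h1, rfl⟩
    exact ⟨t, ⟨h0, h1⟩, rfl⟩

/-- For collinear points, being lexicographically between two points means lying on their segment.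
This replaces metric estimates in the intersection criteria below. -/
theorem mem_segment_of_cr_eq_zero {a b c : ℂ} (hac : IsUp (c - a)) (hcb : IsUp (b - c))
    (h : cr (b - a) (c - a) = 0) : c ∈ segment ℝ a b := by
  have hab : IsUp (b - a) := by simpa using hcb.add hac
  obtain ⟨r, hr⟩ := exists_smul_of_cr_eq_zero hab.ne_zero h
  rw [hr] at hac
  have h0 := hab.pos_of_smul hac
  have e : b - c = (1 - r) • (b - a) := by rw [sub_smul, ← hr, one_smul]; ring
  rw [e] at hcb
  have h1 := hab.pos_of_smul hcb
  exact mem_segment_iff.2 ⟨r, h0.le, by linarith, by rw [← hr]; ring⟩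

/-- The determinant with `b - a` is affine along `cd`, so `cd` meets the line `ab` exactly when `c`
and `d` lie on opposite sides. The meeting point is between `a` and `b` because `c` and `d` are. -/
theorem segments_meet_iff_of_nested {a b c d : ℂ} (hac : IsUp (c - a)) (had : IsUp (d - a))
    (hcb : IsUp (b - c)) (hdb : IsUp (b - d)) (h1 : cr (b - a) (c - a) ≠ 0)
    (h2 : cr (b - a) (d - a) ≠ 0) :
    (∃ p, p ∈ segment ℝ a b ∧ p ∈ segment ℝ c d) ↔
      ¬ (0 < cr (b - a) (c - a) ↔ 0 < cr (b - a) (d - a)) := by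
  set o₁ := cr (b - a) (c - a) with ho₁
  set o₂ := cr (b - a) (d - a) with ho₂
  have hlin : ∀ t : ℝ, cr (b - a) (c + t • (d - c) - a) = (1 - t) * o₁ + t * o₂ := by
    intro t
    simp only [ho₁, ho₂, cr, Complex.sub_re, Complex.sub_im, Complex.add_re, Complex.add_im,
      Complex.smul_re, Complex.smul_im, smul_eq_mul]
    ring
  constructor
  · rintro ⟨p, hp, hp'⟩ hiff
    obtain ⟨s, hs0, hs1, hs⟩ := mem_segment_iff.1 hp
    obtain ⟨t, ht0, ht1, rfl⟩ := mem_segment_iff.1 hp'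
    have e := hlin t
    rw [hs] at e
    have e0 : cr (b - a) (a + s • (b - a) - a) = 0 := by
      simp only [cr, Complex.sub_re, Complex.sub_im, Complex.add_re, Complex.add_im,
        Complex.smul_re, Complex.smul_im, smul_eq_mul]
      ring
    rw [e0] at e
    rcases lt_or_gt_of_ne h1 with h | h
    · have h' : o₂ < 0 := lt_of_le_of_ne (not_lt.1 fun h' => (hiff.2 h').not_gt h) h2
      rcases ht0.eq_or_lt with rfl | ht0
      · linarith
      · nlinarith [mul_pos ht0 (neg_pos.2 h'), mul_nonneg (sub_nonneg.2 ht1) (neg_pos.2 h).le]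
    · have h' := hiff.1 h
      rcases ht0.eq_or_lt with rfl | ht0
      · linarith
      · nlinarith [mul_pos ht0 h', mul_nonneg (sub_nonneg.2 ht1) h.le]
  · intro hiff
    have hne : o₁ - o₂ ≠ 0 := by
      intro e
      rw [sub_eq_zero.1 e] at hiff
      exact hiff Iff.rfl
    have ht : 0 < o₁ / (o₁ - o₂) ∧ 0 < 1 - o₁ / (o₁ - o₂) := by
      have e : 1 - o₁ / (o₁ - o₂) = -o₂ / (o₁ - o₂) := by field_simp; ring
      rw [e]
      rcases lt_or_gt_of_ne h1 with h | h
      · have h' : 0 < o₂ := by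
          by_contra h'
          exact hiff ⟨fun h'' => absurd h'' h.not_gt, fun h'' => absurd h'' h'⟩
        exact ⟨div_pos_of_neg_of_neg h (by linarith), div_pos_of_neg_of_neg (by linarith)
          (by linarith)⟩
      · have h' : o₂ < 0 := by
          refine lt_of_le_of_ne (not_lt.1 fun h' => hiff ⟨fun _ => h', fun _ => h⟩) h2
        exact ⟨div_pos h (by linarith), div_pos (by linarith) (by linarith)⟩
    have e0 := hlin (o₁ / (o₁ - o₂))
    set t := o₁ / (o₁ - o₂) with htdef
    have ez : (1 - t) * o₁ + t * o₂ = 0 := by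
      rw [htdef]
      field_simp
      ring
    refine ⟨c + t • (d - c), ?_, mem_segment_iff.2 ⟨t, ht.1.le, by linarith [ht.2], rfl⟩⟩
    apply mem_segment_of_cr_eq_zero
    · have := (hac.smul ht.2).add (had.smul ht.1)
      convert this using 1
      simp only [sub_smul, smul_sub, one_smul]
      ring
    · have := (hcb.smul ht.2).add (hdb.smul ht.1)
      convert this using 1
      simp only [sub_smul, smul_sub, one_smul]
      ring
    · rw [e0, ez]

theorem segments_meet_iff_of_interlaced {a b c d : ℂ} (hac : IsUp (c - a)) (hcb : IsUp (b - c))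
    (hbd : IsUp (d - b)) (h1 : cr (b - a) (c - a) ≠ 0) (h2 : cr (d - c) (b - c) ≠ 0) :
    (∃ p, p ∈ segment ℝ a b ∧ p ∈ segment ℝ c d) ↔
      (0 < cr (b - a) (c - a) ↔ 0 < cr (d - c) (b - c)) := by
  have hab : IsUp (b - a) := by simpa using hcb.add hac
  have hcd : IsUp (d - c) := by simpa using hbd.add hcb
  set o₁ := cr (b - a) (c - a) with ho₁
  set o₂ := cr (d - c) (b - c) with ho₂
  set k := cr (d - c) (b - a) with hk
  constructor
  · rintro ⟨p, hp, hp'⟩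
    obtain ⟨s, hs0, hs1, hs⟩ := mem_segment_iff.1 hp
    obtain ⟨t, ht0, ht1, ht⟩ := mem_segment_iff.1 hp'
    have e := hs.symm.trans ht
    have er := congrArg Complex.re e
    have ei := congrArg Complex.im e
    simp only [Complex.sub_re, Complex.sub_im, Complex.add_re, Complex.add_im,
      Complex.smul_re, Complex.smul_im, smul_eq_mul] at er ei
    have e1 : o₁ = t * k := by
      simp only [ho₁, hk, cr, Complex.sub_re, Complex.sub_im]
      linear_combination (b.im - a.im) * er - (b.re - a.re) * ei
    have e2 : o₂ = (1 - s) * k := by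
      simp only [ho₂, hk, cr, Complex.sub_re, Complex.sub_im]
      linear_combination (d.re - c.re) * ei - (d.im - c.im) * er
    rw [e1, e2]
    have ht : 0 < t := lt_of_le_of_ne ht0 fun h => h1 (by rw [e1, ← h, zero_mul])
    have hs : 0 < 1 - s := lt_of_le_of_ne (by linarith) fun h => h2 (by rw [e2, ← h, zero_mul])
    rw [mul_pos_iff_of_pos_left ht, mul_pos_iff_of_pos_left hs]
  -- Cramer's rule for the intersection of the two lines, at parameter `1 - o₂ / k` on `ab` and `o₁
  -- / k` on `cd`. That both parameters lie in `[0, 1]` follows from the order of the four points.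
  · have e1 : k • (c - a) = (k - o₂) • (b - a) - o₁ • (d - c) := by
      apply Complex.ext <;>
      simp only [ho₁, ho₂, hk, cr, Complex.sub_re, Complex.sub_im, Complex.smul_re,
        Complex.smul_im, smul_eq_mul] <;>
      ring
    have main : ∀ k o₁ o₂ : ℝ, 0 < o₁ → 0 < o₂ →
        k • (c - a) = (k - o₂) • (b - a) - o₁ • (d - c) →
        ∃ p, p ∈ segment ℝ a b ∧ p ∈ segment ℝ c d := by
      clear * - hac hcb hbd hab hcd
      intro k o₁ o₂ h1 h2 e
      have hk : 0 < k := by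
        by_contra hk
        have u : IsUp (o₁ • (d - c) + o₂ • (b - a)) := (hcd.smul h1).add (hab.smul h2)
        have e' : o₁ • (d - c) + o₂ • (b - a) = k • (b - c) := by
          simp only [Complex.real_smul, Complex.ofReal_sub] at e ⊢
          linear_combination e
        rw [e'] at u
        exact hk (hcb.pos_of_smul u)
      have hk2 : 0 < k - o₂ := by
        have u := (hac.smul hk).add (hcd.smul h1)
        rw [e, sub_add_cancel] at u
        exact hab.pos_of_smul u
      have hk1 : 0 < k - o₁ := by
        have u := (hbd.smul hk).add (hab.smul h2)
        have e' : k • (d - b) + o₂ • (b - a) = (k - o₁) • (d - c) := by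
          simp only [Complex.real_smul, Complex.ofReal_sub] at e ⊢
          linear_combination e
        rw [e'] at u
        exact hcd.pos_of_smul u
      have e2 : a + (1 - o₂ / k) • (b - a) = c + (o₁ / k) • (d - c) := by
        have hkc : (k : ℂ) ≠ 0 := by exact_mod_cast hk.ne'
        simp only [Complex.real_smul] at e ⊢
        push_cast at e ⊢
        field_simp
        linear_combination -e
      refine ⟨_, mem_segment_iff.2 ⟨1 - o₂ / k, ?_, ?_, rfl⟩, mem_segment_iff.2
        ⟨o₁ / k, ?_, ?_, e2⟩⟩
      · have : o₂ / k ≤ 1 := (div_le_one hk).2 (by linarith)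
        linarith
      · have : 0 < o₂ / k := div_pos h2 hk
        linarith
      · exact (div_pos h1 hk).le
      · exact (div_le_one hk).2 (by linarith)
    intro hiff
    rcases lt_or_gt_of_ne h1 with h | h
    · have h' : o₂ < 0 := lt_of_le_of_ne (not_lt.1 fun h' => (hiff.2 h').not_gt h) h2
      refine main (-k) (-o₁) (-o₂) (by linarith) (by linarith) ?_
      rw [neg_smul, e1]
      simp only [sub_smul, neg_smul]
      ring
    · exact main k o₁ o₂ h (hiff.1 h) e1

theorem segments_not_meet_of_above {a b c d p : ℂ} (hab : IsUp (b - a)) (hbc : IsUp (c - b))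
    (hcd : IsUp (d - c)) (hp : p ∈ segment ℝ a b) : p ∉ segment ℝ c d := by
  intro hp'
  obtain ⟨s, hs0, hs1, hs⟩ := mem_segment_iff.1 hp
  obtain ⟨t, ht0, ht1, ht⟩ := mem_segment_iff.1 hp'
  have key : ∀ {z : ℂ} {r : ℝ}, 0 ≤ r → IsUp z → ∀ {w}, IsUp w → IsUp (w + r • z) := by
    intro z r hr hz w hw
    rcases hr.eq_or_lt with rfl | hr
    · simpa using hw
    · exact hw.add (hz.smul hr)
  have h := key ht0 hcd (key (sub_nonneg.2 hs1) hab hbc)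
  refine h.ne_zero ?_
  have e := hs.symm.trans ht
  rw [sub_smul, one_smul]
  linear_combination -e

/-- The argument of `z` in the interval `(-π/2, 3π/2]`. -/
noncomputable def branchArg (z : ℂ) : ℝ :=
  open scoped Classical in if IsUp z then z.arg else (-z).arg + Real.pi

theorem IsUp.arg_mem {z : ℂ} (h : IsUp z) : -(Real.pi / 2) < z.arg ∧ z.arg ≤ Real.pi / 2 := by
  rcases h with h | ⟨h1, h2⟩
  · have := Complex.abs_arg_lt_pi_div_two_iff.2 (.inl h)
    rw [abs_lt] at this
    exact ⟨this.1, this.2.le⟩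
  · have hz : z = z.im * Complex.I := Complex.ext (by simp [h1]) (by simp)
    have : z.arg = Real.pi / 2 := by
      rw [hz, Complex.arg_real_mul _ h2, Complex.arg_I]
    rw [this]
    exact ⟨by linarith [Real.pi_pos], le_rfl⟩

theorem IsUp.branchArg_eq {z : ℂ} (h : IsUp z) : branchArg z = z.arg := if_pos h

theorem IsUp.branchArg_neg {z : ℂ} (h : IsUp z) : branchArg (-z) = z.arg + Real.pi := by
  rw [branchArg, if_neg h.not_neg, neg_neg]

/-- The determinant is `‖z‖ ‖w‖` times the sine of the difference of the arguments, which lies in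
`(-π, π)` for two upward vectors. -/
theorem IsUp.cr_pos_iff {z w : ℂ} (hz : IsUp z) (hw : IsUp w) : 0 < cr z w ↔ z.arg < w.arg := by
  have e : cr z w = ‖z‖ * ‖w‖ * Real.sin (w.arg - z.arg) := by
    rw [Real.sin_sub, cr]
    nth_rewrite 1 [← Complex.norm_mul_cos_arg z, ← Complex.norm_mul_cos_arg w,
      ← Complex.norm_mul_sin_arg z, ← Complex.norm_mul_sin_arg w]
    ring
  rw [e, mul_pos_iff_of_pos_left (mul_pos (norm_pos_iff.2 hz.ne_zero) (norm_pos_iff.2 hw.ne_zero))]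
  have h1 := hz.arg_mem
  have h2 := hw.arg_mem
  constructor
  · intro h
    by_contra! h'
    exact h.not_ge (Real.sin_nonpos_of_nonpos_of_neg_pi_le (by linarith) (by linarith))
  · intro h
    exact Real.sin_pos_of_pos_of_lt_pi (by linarith) (by linarith)

theorem norm_mul_exp_branchArg {z : ℂ} (hz : z ≠ 0) :
    (‖z‖ : ℂ) * Complex.exp (branchArg z * Complex.I) = z := by
  rcases isUp_or_isUp_neg hz with h | h
  · rw [h.branchArg_eq, Complex.norm_mul_exp_arg_mul_I]
  · have e := h.branchArg_neg
    rw [neg_neg] at e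
    rw [e]
    push_cast
    rw [add_mul, Complex.exp_add, Complex.exp_pi_mul_I, mul_neg_one, mul_neg, ← norm_neg,
      Complex.norm_mul_exp_arg_mul_I, neg_neg]

theorem exists_smul_of_branchArg_eq {z w : ℂ} (hz : z ≠ 0) (hw : w ≠ 0)
    (h : branchArg z = branchArg w) : ∃ r : ℝ, 0 < r ∧ z = r • w := by
  refine ⟨‖z‖ / ‖w‖, div_pos (norm_pos_iff.2 hz) (norm_pos_iff.2 hw), ?_⟩
  rw [Complex.real_smul]
  have hn : (‖w‖ : ℂ) ≠ 0 := by exact_mod_cast (norm_pos_iff.2 hw).ne'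
  have h1 := norm_mul_exp_branchArg hz
  have h2 := norm_mul_exp_branchArg hw
  rw [h] at h1
  calc z = ‖z‖ * Complex.exp (branchArg w * Complex.I) := h1.symm
    _ = ((‖z‖ / ‖w‖ : ℝ) : ℂ) * (‖w‖ * Complex.exp (branchArg w * Complex.I)) := by
      push_cast
      field_simp
    _ = _ := by rw [h2]

theorem arg_div_of_branchArg {z w : ℂ} (hz : z ≠ 0) (hw : w ≠ 0) (k : ℤ)
    (h : branchArg w - branchArg z + k * (2 * Real.pi) ∈ Set.Ioc (-Real.pi) Real.pi) :
    (w / z).arg = branchArg w - branchArg z + k * (2 * Real.pi) := by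
  have hr : 0 < ‖w‖ / ‖z‖ := div_pos (norm_pos_iff.2 hw) (norm_pos_iff.2 hz)
  have e : w / z = ((‖w‖ / ‖z‖ : ℝ) : ℂ) *
      Complex.exp (((branchArg w - branchArg z + k * (2 * Real.pi) : ℝ) : ℂ) * Complex.I) := by
    nth_rewrite 1 [← norm_mul_exp_branchArg hz, ← norm_mul_exp_branchArg hw]
    push_cast
    rw [add_mul, sub_mul, Complex.exp_add, Complex.exp_sub]
    rw [show (k : ℂ) * (2 * Real.pi) * Complex.I = k * (2 * Real.pi * Complex.I) by ring,
      Complex.exp_int_mul_two_pi_mul_I]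
    ring
  rw [e, Complex.exp_mul_I, Complex.arg_mul_cos_add_sin_mul_I hr h]

end Plane

/-! ### The sign of a loop in terms of the order of half-edges -/

section Signs

variable {V : Type*} {G : SimpleGraph V} (D : Drawing G)

theorem coords_lt_iff {u v : V} : D.coords u < D.coords v ↔ IsUp (D.pos v - D.pos u) := by
  rw [Drawing.coords, Drawing.coords, Prod.Lex.toLex_lt_toLex]
  simp only [IsUp, Complex.sub_re, Complex.sub_im, sub_pos, sub_eq_zero]
  rw [eq_comm]

theorem pos_sub_ne_zero {u v : V} (h : u ≠ v) : D.pos v - D.pos u ≠ 0 :=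
  sub_ne_zero.2 fun e => h (D.pos_injective e).symm

/-- The position of a half-edge in the order by vertices, and clockwise at each vertex. -/
noncomputable def key (x : V × V) : Lex (Lex (ℝ × ℝ) × ℝ) :=
  toLex (D.coords x.1, -branchArg (D.pos x.2 - D.pos x.1))

theorem key_lt_of_coords_lt {x y : V × V} (h : D.coords x.1 < D.coords y.1) :
    key D x < key D y := by
  rw [key, key, Prod.Lex.toLex_lt_toLex]
  exact .inl h

theorem key_lt_iff {u v w : V} : key D (u, v) < key D (u, w) ↔
    branchArg (D.pos w - D.pos u) < branchArg (D.pos v - D.pos u) := by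
  rw [key, key, Prod.Lex.toLex_lt_toLex]
  simp

theorem ordSign_of_lt {x y : V × V} (h : D.coords x.1 < D.coords y.1) :
    ordSign (key D) x y = 1 := if_pos (key_lt_of_coords_lt D h)

theorem ordSign_of_gt {x y : V × V} (h : D.coords y.1 < D.coords x.1) :
    ordSign (key D) x y = -1 := if_neg (key_lt_of_coords_lt D h).not_gt

/-- Distinct edges at a vertex have distinct directions. -/
theorem pos_sub_ne_smul {u v w : V} (hv : G.Adj u v) (hw : G.Adj u w) (hvw : v ≠ w) {r : ℝ}
    (hr : 0 < r) : D.pos v - D.pos u ≠ r • (D.pos w - D.pos u) := by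
  intro e
  rcases le_total r 1 with h1 | h1
  · refine D.notMem_edge u w v hw hv.ne' hvw (mem_segment_iff.2 ⟨r, hr.le, h1, ?_⟩)
    rw [← e]
    ring
  · refine D.notMem_edge u v w hv hw.ne' hvw.symm (mem_segment_iff.2 ⟨r⁻¹, (inv_pos.2 hr).le,
      inv_le_one_of_one_le₀ h1, ?_⟩)
    rw [e, smul_smul, inv_mul_cancel₀ hr.ne', one_smul]
    ring

theorem branchArg_ne {u v w : V} (hv : G.Adj u v) (hw : G.Adj u w) (hvw : v ≠ w) :
    branchArg (D.pos v - D.pos u) ≠ branchArg (D.pos w - D.pos u) := by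
  intro e
  obtain ⟨r, hr, h⟩ := exists_smul_of_branchArg_eq (pos_sub_ne_zero D hv.ne)
    (pos_sub_ne_zero D hw.ne) e
  exact pos_sub_ne_smul D hv hw hvw hr h

theorem key_injOn : Set.InjOn (key D) {x : V × V | G.Adj x.1 x.2} := by
  rintro ⟨u, v⟩ hv ⟨u', w⟩ hw h
  have h' := toLex.injective h
  simp only [Prod.mk.injEq, neg_inj] at h'
  obtain ⟨h1, h2⟩ := h'
  obtain rfl := coords_injective D h1
  by_contra hne
  exact branchArg_ne D hv hw (fun e => hne (Prod.ext rfl e)) h2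

/-- The turning angle is the difference of the two values of `branchArg` plus `2πk` with `k ∈ {-1,
0, 1}`, so its half contributes `(-1) ^ k`. Whether a correction is needed depends on whether `uv`
goes up and on which side of the backward direction `u - v` the new direction falls in the range of
`branchArg`: these are the two order signs. -/
theorem exp_turn {u v w : V} (huv : G.Adj u v) (hvw : G.Adj v w) (hne : w ≠ u) :
    Complex.exp (Complex.I / 2 * (D.turn u v w : ℂ)) =
      (((ordSign (key D) (u, v) (v, u) * ordSign (key D) (v, u) (v, w) : ℤˣ) : ℤ) : ℂ) *
        Complex.exp (Complex.I / 2 * ((branchArg (D.pos w - D.pos v) : ℂ)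
          - (branchArg (D.pos v - D.pos u) : ℂ))) := by
  have hpi := Real.pi_pos
  have hz := pos_sub_ne_zero D huv.ne
  have hz' := pos_sub_ne_zero D hvw.ne
  have hb := branchArg_ne D huv.symm hvw hne.symm
  have hneg : D.pos u - D.pos v = -(D.pos v - D.pos u) := by ring
  have hrange : -(Real.pi / 2) < branchArg (D.pos w - D.pos v) ∧
      branchArg (D.pos w - D.pos v) ≤ 3 * Real.pi / 2 := by
    rcases isUp_or_isUp_neg hz' with h | h
    · rw [h.branchArg_eq]
      have := h.arg_mem
      constructor <;> linarith
    · have e := h.branchArg_neg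
      rw [neg_neg] at e
      rw [e]
      have := h.arg_mem
      constructor <;> linarith
  have key0 : ∀ k : ℤ, D.turn u v w = branchArg (D.pos w - D.pos v)
      - branchArg (D.pos v - D.pos u) + k * (2 * Real.pi) →
      Complex.exp (Complex.I / 2 * (D.turn u v w : ℂ)) = (-1) ^ k *
        Complex.exp (Complex.I / 2 * ((branchArg (D.pos w - D.pos v) : ℂ)
          - (branchArg (D.pos v - D.pos u) : ℂ))) := by
    intro k hk
    rw [hk]
    push_cast
    rw [mul_add, Complex.exp_add, mul_comm, ← Complex.exp_pi_mul_I, ← Complex.exp_int_mul]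
    congr 2
    ring
  have keyp := key0 0
  have keym := key0 (-1)
  have keyq := key0 1
  simp only [Drawing.turn] at keyp keym keyq ⊢
  rcases isUp_or_isUp_neg hz with h | h
  · have hs : ordSign (key D) (u, v) (v, u) = 1 := ordSign_of_lt D ((coords_lt_iff D).2 h)
    have hθ := h.arg_mem
    rw [hneg, h.branchArg_neg] at hb
    rw [hs, one_mul, ordSign]
    simp only [key_lt_iff]
    rw [hneg, h.branchArg_neg]
    rw [h.branchArg_eq] at keyp keym keyq ⊢
    split_ifs with hlt
    · rw [keyp]
      · simp
      · rw [arg_div_of_branchArg hz hz' 0, h.branchArg_eq]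
        rw [h.branchArg_eq]
        constructor <;> push_cast <;> linarith
    · rw [keym]
      · simp
      · have hlt := lt_of_le_of_ne (not_lt.1 hlt) hb
        rw [arg_div_of_branchArg hz hz' (-1), h.branchArg_eq]
        rw [h.branchArg_eq]
        constructor <;> push_cast <;> linarith
  · have hs : ordSign (key D) (u, v) (v, u) = -1 :=
      ordSign_of_gt D ((coords_lt_iff D).2 (by rwa [neg_sub] at h))
    have hθ := h.arg_mem
    have hzb := h.branchArg_neg
    rw [neg_neg] at hzb
    rw [hneg, h.branchArg_eq] at hb
    rw [hs, ordSign]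
    simp only [key_lt_iff]
    rw [hneg, h.branchArg_eq]
    rw [hzb] at keyp keym keyq ⊢
    split_ifs with hlt
    · rw [keyq]
      · simp
      · rw [arg_div_of_branchArg hz hz' 1, hzb]
        rw [hzb]
        constructor <;> push_cast <;> linarith
    · rw [keyp]
      · simp
      · have hlt := lt_of_le_of_ne (not_lt.1 hlt) hb
        rw [arg_div_of_branchArg hz hz' 0, hzb]
        rw [hzb]
        constructor <;> push_cast <;> linarith

/-- The chords that join the two half-edges of each edge of a loop. -/
def edgeChords (l : List V) : List ((V × V) × (V × V)) :=
  (l.zip (l.rotate 1)).map fun x => (x, x.swap)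

/-- The chords that join the incoming to the outgoing half-edge at each vertex of a loop. -/
def turnChords (l : List V) : List ((V × V) × (V × V)) :=
  (l.zip ((l.rotate 1).zip (l.rotate 2))).map fun t => ((t.2.1, t.1), (t.2.1, t.2.2))

theorem edgeChords_listOf {p : ℤ → V} {n : ℕ} (hp : Function.Periodic p (n : ℤ)) :
    edgeChords (listOf p n)
      = (List.range n).map fun i : ℕ => ((p i, p (i + 1)), (p (i + 1), p i)) := by
  rw [edgeChords, rotate_listOf hp]
  apply List.ext_getElem
  · simp
  · intro i h1 h2
    simp

theorem turnChords_listOf {p : ℤ → V} {n : ℕ} (hp : Function.Periodic p (n : ℤ)) :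
    turnChords (listOf p n)
      = (List.range n).map fun i : ℕ => ((p (i + 1), p i), (p (i + 1), p (i + 2))) := by
  rw [turnChords, rotate_listOf hp, rotate_listOf hp]
  apply List.ext_getElem
  · simp
  · intro i h1 h2
    simp

theorem windingAngle_listOf {p : ℤ → V} {n : ℕ} (hp : Function.Periodic p (n : ℤ)) :
    D.windingAngle (listOf p n) = ∑ i ∈ Finset.range n, D.turn (p i) (p (i + 1)) (p (i + 2)) := by
  rw [Drawing.windingAngle, rotate_listOf hp, rotate_listOf hp, Finset.sum_range, ← List.sum_ofFn]
  congr 1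
  apply List.ext_getElem
  · simp
  · intro i h1 h2
    simp

/-- In the product of the formulas `exp_turn` around the circuit, the exponentials telescope to `1`
and only order signs remain. -/
theorem sgn_listOf {p : ℤ → V} {n : ℕ} (hp : IsCircuit G p n) :
    D.sgn (listOf p n) = (((-(((edgeChords (listOf p n)).map
      fun k => ordSign (key D) k.1 k.2).prod * ((turnChords (listOf p n)).map
        fun k => ordSign (key D) k.1 k.2).prod) : ℤˣ) : ℤ) : ℂ) := by
  rw [edgeChords_listOf hp.periodic, turnChords_listOf hp.periodic, Drawing.sgn,
    windingAngle_listOf D hp.periodic]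
  simp only [List.map_map, Function.comp_def]
  rw [← List.prod_map_mul]
  have hprod : ∀ g : ℕ → ℤˣ, ((((List.range n).map g).prod : ℤˣ) : ℤ)
      = ∏ i ∈ Finset.range n, ((g i : ℤˣ) : ℤ) := by
    intro g
    rw [← Units.coeHom_apply, map_list_prod, Finset.prod_range, ← List.prod_ofFn, List.map_map]
    congr 1
    apply List.ext_getElem <;> simp
  rw [Units.val_neg, hprod]
  push_cast
  rw [Finset.mul_sum, Complex.exp_sum]
  congr 1
  set θ : ℕ → ℂ := fun i => Complex.I / 2 * (branchArg (D.pos (p (i + 1)) - D.pos (p i)) : ℂ)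
    with hθ
  have hturn : ∀ i ∈ Finset.range n,
      Complex.exp (Complex.I / 2 * (D.turn (p i) (p (i + 1)) (p (i + 2)) : ℂ)) =
      (((ordSign (key D) (p i, p (i + 1)) (p (i + 1), p i) *
        ordSign (key D) (p (i + 1), p i) (p (i + 1), p (i + 2)) : ℤˣ) : ℤ) : ℂ) *
        Complex.exp (θ (i + 1) - θ i) := by
    intro i _
    have h1 := hp.adj (i + 1)
    rw [show (i : ℤ) + 1 + 1 = i + 2 by ring] at h1
    rw [exp_turn D (hp.adj i) h1 (hp.ne i)]
    simp only [hθ]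
    push_cast
    rw [show (i : ℤ) + 1 + 1 = i + 2 by ring, mul_sub]
  rw [Finset.prod_congr rfl hturn, Finset.prod_mul_distrib, ← Complex.exp_sum,
    Finset.sum_range_sub]
  have hn : θ n = θ 0 := by
    have e0 : p n = p 0 := by simpa using hp.periodic 0
    have e1 : p (n + 1) = p 1 := by rw [add_comm]; exact hp.periodic 1
    simp only [hθ]
    rw [e0, e1]
    simp
  rw [hn, sub_self, Complex.exp_zero, mul_one]
  push_cast
  rfl

/-- Both sides are the list `a 0, b 0, a 1, b 1, …, a n`, with the pairs starting at its first or at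
its second entry. -/
theorem endpoints_interlace {α : Type*} (a b : ℕ → α) (n : ℕ) :
    endpoints ((List.range n).map fun i => (a i, b i)) ++ [a n]
      = a 0 :: endpoints ((List.range n).map fun i => (b i, a (i + 1))) := by
  induction n with
  | zero => rfl
  | succ n ih =>
    have happ : ∀ K K' : List (α × α), endpoints (K ++ K') = endpoints K ++ endpoints K' :=
      fun K K' => by simp [endpoints]
    rw [List.range_succ, List.map_append, List.map_append, happ, happ, ← List.cons_append, ← ih]
    simp [endpoints]

theorem exists_endpoints_rotate {p : ℤ → V} {n : ℕ} (hp : IsCircuit G p n) :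
    ∃ a M, endpoints (edgeChords (listOf p n)) = a :: M ∧
      endpoints (turnChords (listOf p n)) = M ++ [a] ∧ Odd M.length := by
  have h := endpoints_interlace (fun i : ℕ => (p i, p (i + 1))) (fun i : ℕ => (p (i + 1), p i)) n
  have e0 : p n = p 0 := by simpa using hp.periodic 0
  have e1 : p (n + 1) = p 1 := by rw [add_comm]; exact hp.periodic 1
  rw [e0, e1, ← edgeChords_listOf hp.periodic] at h
  have hT : ((List.range n).map fun i : ℕ => ((p (i + 1), p i), (p ((i + 1 : ℕ) : ℤ),
      p (((i + 1 : ℕ) : ℤ) + 1)))) = turnChords (listOf p n) := by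
    rw [turnChords_listOf hp.periodic]
    refine List.map_congr_left fun i _ => ?_
    push_cast
    rw [show (i : ℤ) + 1 + 1 = i + 2 by ring]
  rw [hT] at h
  have hlen : (endpoints (edgeChords (listOf p n))).length = 2 * n := by
    rw [edgeChords_listOf hp.periodic]
    simp [endpoints, mul_comm, Function.comp_def]
  have hpos := hp.pos
  rcases hE : endpoints (edgeChords (listOf p n)) with _ | ⟨a, M⟩
  · rw [hE] at hlen
    simp at hlen
    omega
  · rw [hE, List.cons_append, List.cons.injEq] at h
    obtain ⟨rfl, h⟩ := h
    refine ⟨_, M, rfl, ?_, ?_⟩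
    · rw [← h]
      simp
    · rw [hE, List.length_cons] at hlen
      exact ⟨n - 1, by omega⟩

theorem map_edgeChords (l : List V) :
    (edgeChords l).map (fun k => s(k.1.1, k.1.2)) = edgeList l := by
  simp [edgeChords, edgeList, List.zip, List.map_zipWith]

theorem nodup_endpoints {K : List ((V × V) × (V × V))} (hK : ∀ k ∈ K, k.2 = k.1.swap)
    (hne : ∀ k ∈ K, k.1.1 ≠ k.1.2) (hnd : (K.map fun k => s(k.1.1, k.1.2)).Nodup) :
    (endpoints K).Nodup := by
  unfold endpoints
  rw [List.nodup_flatMap]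
  constructor
  · intro k hk
    have h1 := hne k hk
    rw [hK k hk]
    simp only [List.nodup_cons, List.mem_cons, List.not_mem_nil, or_false, not_false_eq_true,
      List.nodup_nil, and_self, and_true]
    intro e
    exact h1 (congrArg Prod.fst e)
  · rw [List.Nodup, List.pairwise_map] at hnd
    refine hnd.imp_of_mem ?_
    intro k k' hk hk' h
    simp only [Function.onFun, hK k hk, hK k' hk', List.disjoint_cons_left,
      List.mem_cons, List.not_mem_nil, or_false, not_or, List.disjoint_nil_left, and_true]
    have h1 : k.1 ≠ k'.1 := fun e => h (by rw [e])
    have h2 : k.1 ≠ k'.1.swap := fun e => h (by rw [e, Prod.fst_swap, Prod.snd_swap, Sym2.eq_swap])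
    refine ⟨⟨h1, h2⟩, fun e => h2 (by rw [← e, Prod.swap_swap]), fun e => h1 ?_⟩
    exact Prod.swap_injective e

end Signs

/-! ### The sign of a collection as a product of two crossing parities -/

section CollectionSign

variable {V : Type*} [Fintype V] {G : SimpleGraph V} (D : Drawing G)

theorem key_injOn_halfEdges {F : Finset (Sym2 V)} (hF : ∀ u v, s(u, v) ∈ F → G.Adj u v) :
    Set.InjOn (key D) (halfEdges F) :=
  (key_injOn D).mono fun _ hx => hF _ _ (mem_halfEdges.1 hx)

/-- The sign of a collection of loops in terms of crossings of chords. -/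
theorem collectionSgn_eq {F : Finset (Sym2 V)} (hF : ∀ u v, s(u, v) ∈ F → G.Adj u v)
    {S : Finset (List V)} (hS : S ∈ D.decompositions F) {f : Equiv.Perm (V × V)}
    (hf : f ∈ matchings (halfEdges F) Prod.fst) (hfS : CollectionFollows (G := G) f S) :
    D.collectionSgn S = (((matchSign (key D) (halfEdges F) Prod.swap *
      matchSign (key D) (halfEdges F) f : ℤˣ) : ℤ) : ℂ) := by
  classical
  have hff := (mem_matchings.1 hf).1
  have hκ := key_injOn_halfEdges D hF
  rw [mem_decompositions] at hS
  have hcirc : ∀ l ∈ S, ∃ p n, IsCircuit G p n ∧ l = listOf p n := fun l hl =>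
    exists_isCircuit_of_mem D hS.1 hl
  have hEmem : ∀ k ∈ S.toList.flatMap edgeChords, k.2 = k.1.swap ∧ s(k.1.1, k.1.2) ∈ F := by
    intro k hk
    obtain ⟨l, hl, hk⟩ := List.mem_flatMap.1 hk
    constructor
    · obtain ⟨x, -, rfl⟩ := List.mem_map.1 hk
      rfl
    · refine (hS.2 _).2 ⟨l, Finset.mem_toList.1 hl, ?_⟩
      rw [loopEdges, List.mem_toFinset, ← map_edgeChords]
      exact List.mem_map.2 ⟨k, hk, rfl⟩
  have hEnd : (endpoints (S.toList.flatMap edgeChords)).Nodup := by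
    apply nodup_endpoints
    · exact fun k hk => (hEmem k hk).1
    · exact fun k hk => (hF _ _ (hEmem k hk).2).ne
    · rw [List.map_flatMap]
      simp only [map_edgeChords]
      rw [List.nodup_flatMap]
      constructor
      · intro l hl
        exact (((mem_edgeDisjointCollections D).1 hS.1).1 l (Finset.mem_toList.1 hl)).2
      · refine (Finset.nodup_toList S).imp_of_mem ?_
        intro l l' hl hl' hne e he he'
        exact hne (eq_of_common_edge_of_mem D hS.1 (Finset.mem_toList.1 hl)
          (Finset.mem_toList.1 hl') (List.mem_toFinset.2 he) (List.mem_toFinset.2 he'))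
  have hEH : ∀ x, x ∈ endpoints (S.toList.flatMap edgeChords) ↔ x ∈ halfEdges F := by
    intro x
    rw [mem_endpoints]
    constructor
    · rintro ⟨k, hk, rfl | rfl⟩
      · exact mem_halfEdges.2 (hEmem k hk).2
      · rw [(hEmem k hk).1, swap_mem_halfEdges]
        exact mem_halfEdges.2 (hEmem k hk).2
    · intro hx
      obtain ⟨l, hl, he⟩ := (hS.2 _).1 (mem_halfEdges.1 hx)
      rw [loopEdges, List.mem_toFinset, ← map_edgeChords] at he
      obtain ⟨k, hk, hkx⟩ := List.mem_map.1 he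
      have hk' : k ∈ S.toList.flatMap edgeChords :=
        List.mem_flatMap.2 ⟨l, Finset.mem_toList.2 hl, hk⟩
      refine ⟨k, hk', ?_⟩
      rw [(hEmem k hk').1]
      rcases Sym2.eq_iff.1 hkx with ⟨e1, e2⟩ | ⟨e1, e2⟩
      · exact .inl (Prod.ext e1.symm e2.symm)
      · exact .inr (Prod.ext e2.symm e1.symm)
  have hrot : ∀ l ∈ S.toList, ∃ a M, endpoints (edgeChords l) = a :: M ∧
      endpoints (turnChords l) = M ++ [a] ∧ Odd M.length ∧
      ∀ y ∈ M, ordSign (key D) y a = -ordSign (key D) a y := by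
    intro l hl
    obtain ⟨p, n, hp, rfl⟩ := hcirc l (Finset.mem_toList.1 hl)
    obtain ⟨a, M, h1, h2, h3⟩ := exists_endpoints_rotate hp
    refine ⟨a, M, h1, h2, h3, fun y hy => ordSign_swap ?_⟩
    have hsub : (endpoints (edgeChords (listOf p n))).Nodup := by
      rw [endpoints_flatMap] at hEnd
      exact (List.nodup_flatMap.1 hEnd).1 _ hl
    rw [h1, List.nodup_cons] at hsub
    have hmem : ∀ z ∈ a :: M, z ∈ halfEdges F := by
      intro z hz
      rw [← h1] at hz
      rw [← hEH, endpoints_flatMap]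
      exact List.mem_flatMap.2 ⟨_, hl, hz⟩
    intro e
    have := hκ (hmem a (by simp)) (hmem y (by simp [hy])) e
    rw [this] at hsub
    exact hsub.1 hy
  have hperm : (endpoints (S.toList.flatMap edgeChords)).Perm
      (endpoints (S.toList.flatMap turnChords)) := by
    rw [endpoints_flatMap, endpoints_flatMap]
    refine List.Perm.flatMap_left _ fun l hl => ?_
    obtain ⟨a, M, h1, h2, -⟩ := hrot l hl
    rw [h1, h2]
    exact (List.perm_append_singleton a M).symm
  have hTf : ∀ k ∈ S.toList.flatMap turnChords, f k.1 = k.2 ∧ f k.2 = k.1 := by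
    intro k hk
    obtain ⟨l, hl, hk⟩ := List.mem_flatMap.1 hk
    obtain ⟨p, n, hp, rfl, hfp⟩ := hfS l (Finset.mem_toList.1 hl)
    rw [turnChords_listOf hp.periodic] at hk
    obtain ⟨i, -, rfl⟩ := List.mem_map.1 hk
    have h1 := hfp (i + 1)
    rw [add_sub_cancel_right, show (i : ℤ) + 1 + 1 = i + 2 by ring] at h1
    exact ⟨h1, by rw [← h1, hff]⟩
  have h1 := pairProd_chordSign_eq_matchSign hκ hEnd (f := Prod.swap)
    (fun k hk => by rw [(hEmem k hk).1]; exact ⟨rfl, Prod.swap_swap _⟩) hEH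
  have h2 := pairProd_chordSign_eq_matchSign hκ (hperm.nodup hEnd) hTf
    fun x => (hperm.mem_iff.symm.trans (hEH x))
  rw [← h1, ← h2, chordSign_mul_chordSign_flatMap _ _ _ _ hrot, Drawing.collectionSgn,
    Finset.prod_map_toList]
  push_cast [Units.coe_prod]
  refine Finset.prod_congr rfl fun l hl => ?_
  obtain ⟨p, n, hp, rfl⟩ := hcirc l hl
  rw [sgn_listOf D hp]
  push_cast
  rfl

end CollectionSign

/-! ### Crossing edges, and vertices to the left of an edge -/

section Crossings

variable {V : Type*} {G : SimpleGraph V} (D : Drawing G)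

/-- Two edges that meet in a point that is not a vertex contribute `-1`. -/
noncomputable def crossSign (e f : Sym2 V) : ℤˣ :=
  open scoped Classical in if D.Cross e f then -1 else 1

theorem cross_comm (e f : Sym2 V) : D.Cross e f ↔ D.Cross f e := by
  have : ∀ e f, D.Cross e f → D.Cross f e := by
    rintro e f ⟨h, p, h1, h2, h3⟩
    exact ⟨h.symm, p, h2, h1, h3⟩
  exact ⟨this e f, this f e⟩

theorem crossSign_comm (e f : Sym2 V) : crossSign D e f = crossSign D f e := by
  have h := cross_comm D e f
  unfold crossSign
  split_ifs <;> tauto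

open scoped Classical in
theorem crossings_insert {e : Sym2 V} {F : Finset (Sym2 V)} (he : e ∉ F) :
    D.crossings (insert e F) = (F.filter (D.Cross e)).card + D.crossings F := by
  have hpair : ∀ f ∈ F, (∃ e' f', ({e, f} : Finset (Sym2 V)) = {e', f'} ∧ D.Cross e' f') ↔
      D.Cross e f := by
    intro f _
    constructor
    · rintro ⟨e', f', h, hc⟩
      have h' : ({e, f} : Set (Sym2 V)) = {e', f'} := by
        rw [← Finset.coe_pair, ← Finset.coe_pair, h]
      rcases Set.pair_eq_pair_iff.1 h' with ⟨rfl, rfl⟩ | ⟨rfl, rfl⟩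
      · exact hc
      · exact (cross_comm D _ _).1 hc
    · exact fun h => ⟨e, f, rfl, h⟩
  rw [Drawing.crossings, Drawing.crossings, Finset.powersetCard_succ_insert he,
    Finset.filter_union, Finset.card_union_of_disjoint, add_comm]
  · congr 1
    rw [Finset.powersetCard_one, Finset.map_eq_image, Finset.image_image, Finset.filter_image,
      Finset.card_image_of_injOn]
    · congr 1
      refine Finset.filter_congr fun f hf => ?_
      exact hpair f hf
    · intro f hf g hg h
      have hfF : f ∈ F := (Finset.mem_filter.1 (Finset.mem_coe.1 hf)).1
      have : f ∈ insert e ({g} : Finset (Sym2 V)) := by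
        have h' : insert e ({f} : Finset (Sym2 V)) = insert e {g} := h
        rw [← h']
        simp
      rcases Finset.mem_insert.1 this with rfl | h
      · exact absurd hfF he
      · exact Finset.mem_singleton.1 h
  · rw [Finset.disjoint_left]
    intro P hP hP'
    have h1 := (Finset.mem_powersetCard.1 (Finset.mem_filter.1 hP).1).1
    obtain ⟨Q, -, rfl⟩ := Finset.mem_image.1 (Finset.mem_filter.1 hP').1
    exact he (h1 (Finset.mem_insert_self _ _))

theorem pairProd_crossSign (F : Finset (Sym2 V)) :
    pairProd (crossSign D) F.toList = (-1) ^ D.crossings F := by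
  classical
  induction F using Finset.induction_on with
  | empty => 
    have : Finset.powersetCard 2 (∅ : Finset (Sym2 V)) = ∅ :=
      Finset.powersetCard_eq_empty.2 (by simp)
    simp [pairProd, Drawing.crossings, this]
  | insert e F he ih =>
    rw [pairProd_perm _ (Finset.toList_insert he) fun x _ y _ => crossSign_comm D x y, pairProd, ih,
      crossings_insert D he, pow_add, Finset.prod_map_toList]
    congr 1
    rw [Finset.prod_congr rfl fun f _ =>
      show crossSign D e f = if D.Cross e f then -1 else 1 from rfl, Finset.prod_ite]
    simp

/-- `-1` if the vertex `v` lies strictly between the endpoints of the edge `x`, and to its left. -/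
noncomputable def leftSign (x : V × V) (v : V) : ℤˣ :=
  open scoped Classical in
  if D.coords x.1 < D.coords v ∧ D.coords v < D.coords x.2 ∧
    0 < cr (D.pos x.2 - D.pos x.1) (D.pos v - D.pos x.1) then -1 else 1

theorem leftSign_of_le_left {x : V × V} {v : V} (h : D.coords v ≤ D.coords x.1) :
    leftSign D x v = 1 := if_neg fun h' => h.not_gt h'.1

theorem leftSign_of_ge_right {x : V × V} {v : V} (h : D.coords x.2 ≤ D.coords v) :
    leftSign D x v = 1 := if_neg fun h' => h.not_gt h'.2.1

theorem leftSign_of_between {x : V × V} {v : V} (h : D.coords x.1 < D.coords v)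
    (h' : D.coords v < D.coords x.2)
    [Decidable (0 < cr (D.pos x.2 - D.pos x.1) (D.pos v - D.pos x.1))] :
    leftSign D x v = if 0 < cr (D.pos x.2 - D.pos x.1) (D.pos v - D.pos x.1) then -1 else 1 := by
  simp only [leftSign, h, h', true_and]

theorem cr_ne_zero {a b c : V} (hab : G.Adj a b) (hac : D.coords a < D.coords c)
    (hcb : D.coords c < D.coords b) : cr (D.pos b - D.pos a) (D.pos c - D.pos a) ≠ 0 := by
  intro h
  refine D.notMem_edge a b c hab ?_ ?_ (mem_segment_of_cr_eq_zero ((coords_lt_iff D).1 hac)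
    ((coords_lt_iff D).1 hcb) h)
  · rintro rfl
    exact lt_irrefl _ hac
  · rintro rfl
    exact lt_irrefl _ hcb

/-- A vertex on both segments would be an endpoint of both edges, as no other vertex lies on an
edge. -/
theorem cross_iff_of_disjoint {a b c d : V} (hab : G.Adj a b) (hcd : G.Adj c d) (hac : a ≠ c)
    (had : a ≠ d) (hbc : b ≠ c) (hbd : b ≠ d) : D.Cross s(a, b) s(c, d) ↔
      ∃ p, p ∈ segment ℝ (D.pos a) (D.pos b) ∧ p ∈ segment ℝ (D.pos c) (D.pos d) := by
  constructor
  · rintro ⟨-, p, h1, h2, -⟩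
    exact ⟨p, h1, h2⟩
  · rintro ⟨p, h1, h2⟩
    refine ⟨?_, p, h1, h2, ?_⟩
    · intro e
      rcases Sym2.eq_iff.1 e with h | h
      · exact hac h.1
      · exact had h.1
    · rintro ⟨w, rfl⟩
      have hw : w = a ∨ w = b := by
        by_contra! h
        exact D.notMem_edge a b w hab h.1 h.2 h1
      have hw' : w = c ∨ w = d := by
        by_contra! h
        exact D.notMem_edge c d w hcd h.1 h.2 h2
      rcases hw with rfl | rfl <;> rcases hw' with h | h <;> contradiction

/-- Meeting away from `a` would give both edges the same direction at `a`, and the end of one would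
lie on the other. -/
theorem not_cross_of_common {a b d : V} (hab : G.Adj a b) (had : G.Adj a d) :
    ¬ D.Cross s(a, b) s(a, d) := by
  rintro ⟨hne, p, h1, h2, h3⟩
  have hbd : b ≠ d := fun e => hne (by rw [e])
  obtain ⟨s, hs0, hs1, hs⟩ := mem_segment_iff.1 (show p ∈ segment ℝ (D.pos a) (D.pos b) from h1)
  obtain ⟨t, ht0, ht1, ht⟩ := mem_segment_iff.1 (show p ∈ segment ℝ (D.pos a) (D.pos d) from h2)
  have hs0 : 0 < s := lt_of_le_of_ne hs0 fun e => h3 ⟨a, by rw [hs, ← e]; simp⟩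
  have ht0 : 0 < t := lt_of_le_of_ne ht0 fun e => h3 ⟨a, by rw [ht, ← e]; simp⟩
  refine pos_sub_ne_smul D hab had hbd (div_pos ht0 hs0) ?_
  have e : s • (D.pos b - D.pos a) = t • (D.pos d - D.pos a) := by
    have := hs.symm.trans ht
    exact add_left_cancel this
  rw [div_eq_inv_mul, mul_smul, ← e, smul_smul, inv_mul_cancel₀ hs0.ne', one_smul]

end Crossings

/-! ### Crossing chords compared with crossing edges, and the proof of (1) -/

section Crossings

variable {V : Type*} {G : SimpleGraph V} (D : Drawing G)

/-- The chords of two edges, both directed upwards, cross if and only if the edges do, up to the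
signs of the endpoints of one edge relative to the other. -/
theorem chordSign_edges_of_lt {a b c d : V} (hab : G.Adj a b) (hcd : G.Adj c d)
    (hlt : D.coords a < D.coords b) (hlt' : D.coords c < D.coords d)
    (hac : D.coords a < D.coords c ∨ a = c ∧ D.coords b < D.coords d) :
    chordSign (ordSign (key D)) ((a, b), (b, a)) ((c, d), (d, c)) =
      crossSign D s(a, b) s(c, d) * ((leftSign D (a, b) c * leftSign D (a, b) d) *
        (leftSign D (c, d) a * leftSign D (c, d) b)) := by
  classical
  have hup := (coords_lt_iff D).1 hlt
  have hup' := (coords_lt_iff D).1 hlt'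
  have hne : ∀ {u v : V}, D.coords u < D.coords v → u ≠ v := fun h e => by
    rw [e] at h
    exact lt_irrefl _ h
  rcases hac with hac | ⟨rfl, hbd⟩
  · have hca : leftSign D (c, d) a = 1 := leftSign_of_le_left D hac.le
    have had := hac.trans hlt'
    have s1 : ordSign (key D) (a, b) (c, d) = 1 := ordSign_of_lt D hac
    have s2 : ordSign (key D) (a, b) (d, c) = 1 := ordSign_of_lt D had
    simp only [chordSign, s1, s2, hca, one_mul]
    rcases lt_trichotomy (D.coords b) (D.coords c) with hbc | hbc | hcb
    · have hbd := hbc.trans hlt'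
      have s3 : ordSign (key D) (b, a) (c, d) = 1 := ordSign_of_lt D hbc
      have s4 : ordSign (key D) (b, a) (d, c) = 1 := ordSign_of_lt D hbd
      have l1 : leftSign D (a, b) c = 1 := leftSign_of_ge_right D hbc.le
      have l2 : leftSign D (a, b) d = 1 := leftSign_of_ge_right D hbd.le
      have l3 : leftSign D (c, d) b = 1 := leftSign_of_le_left D hbc.le
      have hX : crossSign D s(a, b) s(c, d) = 1 := by
        refine if_neg ?_
        rw [cross_iff_of_disjoint D hab hcd (hne hac) (hne had) (hne hbc) (hne hbd)]
        rintro ⟨p, h1, h2⟩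
        exact segments_not_meet_of_above hup ((coords_lt_iff D).1 hbc) hup' h1 h2
      rw [s3, s4, l1, l2, l3, hX]
      rfl
    · obtain rfl := coords_injective D hbc
      have s3 : ordSign (key D) (b, a) (b, d) = 1 := by
        refine if_pos ((key_lt_iff D).2 ?_)
        rw [hup'.branchArg_eq, ← neg_sub (D.pos b) (D.pos a), hup.branchArg_neg]
        have := hup.arg_mem
        have := hup'.arg_mem
        linarith
      have s4 : ordSign (key D) (b, a) (d, b) = 1 := ordSign_of_lt D hlt'
      have l1 : leftSign D (a, b) b = 1 := leftSign_of_ge_right D le_rfl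
      have l2 : leftSign D (a, b) d = 1 := leftSign_of_ge_right D hlt'.le
      have l3 : leftSign D (b, d) b = 1 := leftSign_of_le_left D le_rfl
      have hX : crossSign D s(a, b) s(b, d) = 1 := by
        refine if_neg ?_
        rw [Sym2.eq_swap]
        exact not_cross_of_common D hab.symm hcd
      rw [s3, s4, l1, l2, l3, hX]
      rfl
    · have s3 : ordSign (key D) (b, a) (c, d) = -1 := ordSign_of_gt D hcb
      have o1 := cr_ne_zero D hab hac hcb
      have l1 := leftSign_of_between D (x := (a, b)) hac hcb
      rw [s3, l1]
      rcases lt_trichotomy (D.coords d) (D.coords b) with hdb | hdb | hbd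
      -- Nested: the chords do not cross, and the edges cross exactly when `c` and `d` lie on
      -- different sides of `ab`.
      · have s4 : ordSign (key D) (b, a) (d, c) = -1 := ordSign_of_gt D hdb
        have o2 := cr_ne_zero D hab had hdb
        have l2 := leftSign_of_between D (x := (a, b)) had hdb
        have l3 : leftSign D (c, d) b = 1 := leftSign_of_ge_right D hdb.le
        have hX := cross_iff_of_disjoint D hab hcd (hne hac) (hne had) (hne hcb).symm (hne hdb).symm
        rw [segments_meet_iff_of_nested ((coords_lt_iff D).1 hac) ((coords_lt_iff D).1 had)
          ((coords_lt_iff D).1 hcb) ((coords_lt_iff D).1 hdb) o1 o2] at hX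
        rw [s4, l2, l3, crossSign]
        split_ifs <;> first | rfl | (exfalso; tauto)
      · obtain rfl := coords_injective D hdb
        have l2 : leftSign D (a, d) d = 1 := leftSign_of_ge_right D le_rfl
        have l3 : leftSign D (c, d) d = 1 := leftSign_of_ge_right D le_rfl
        have hX : crossSign D s(a, d) s(c, d) = 1 := by
          refine if_neg ?_
          rw [Sym2.eq_swap, Sym2.eq_swap (a := c)]
          exact not_cross_of_common D hab.symm hcd.symm
        -- At a common upper end, the order of the two half-edges tells on which side of `ad` the
        -- vertex `c` lies.
        have hk : key D (d, a) < key D (d, c) ↔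
            0 < cr (D.pos d - D.pos a) (D.pos c - D.pos a) := by
          rw [key_lt_iff, ← neg_sub (D.pos d), hup'.branchArg_neg, ← neg_sub (D.pos d),
            hup.branchArg_neg, add_lt_add_iff_right, ← hup'.cr_pos_iff hup]
          have e : cr (D.pos d - D.pos c) (D.pos d - D.pos a)
              = cr (D.pos d - D.pos a) (D.pos c - D.pos a) := by
            simp only [cr, Complex.sub_re, Complex.sub_im]
            ring
          rw [e]
        rw [l2, l3, hX, ordSign]
        simp only [hk]
        split_ifs <;> rfl
      -- Interlaced: the chords cross, and the edges fail to cross exactly when one of "`c` is left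
      -- of `ab`" and "`b` is left of `cd`" holds without the other.
      · have s4 : ordSign (key D) (b, a) (d, c) = 1 := ordSign_of_lt D hbd
        have o2 := cr_ne_zero D hcd hcb hbd
        have l2 : leftSign D (a, b) d = 1 := leftSign_of_ge_right D hbd.le
        have l3 := leftSign_of_between D (x := (c, d)) hcb hbd
        have hX := cross_iff_of_disjoint D hab hcd (hne hac) (hne had) (hne hcb).symm (hne hbd)
        rw [segments_meet_iff_of_interlaced ((coords_lt_iff D).1 hac) ((coords_lt_iff D).1 hcb)
          ((coords_lt_iff D).1 hbd) o1 o2] at hX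
        rw [s4, l2, l3, crossSign]
        split_ifs <;> first | rfl | (exfalso; tauto)
  · have s2 : ordSign (key D) (a, b) (d, a) = 1 := ordSign_of_lt D hlt'
    have s3 : ordSign (key D) (b, a) (a, d) = -1 := ordSign_of_gt D hlt
    have s4 : ordSign (key D) (b, a) (d, a) = 1 := ordSign_of_lt D hbd
    have l1 : leftSign D (a, b) a = 1 := leftSign_of_le_left D le_rfl
    have l2 : leftSign D (a, b) d = 1 := leftSign_of_ge_right D hbd.le
    have l3 : leftSign D (a, d) a = 1 := leftSign_of_le_left D le_rfl
    have l4 := leftSign_of_between D (x := (a, d)) hlt hbd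
    have hX : crossSign D s(a, b) s(a, d) = 1 := if_neg (not_cross_of_common D hab hcd)
    have hk : key D (a, b) < key D (a, d) ↔
        0 < cr (D.pos d - D.pos a) (D.pos b - D.pos a) := by
      rw [key_lt_iff, hup.branchArg_eq, hup'.branchArg_eq, ← hup'.cr_pos_iff hup]
    simp only [chordSign]
    rw [s2, s3, s4, l1, l2, l3, l4, hX, ordSign]
    simp only [hk]
    split_ifs <;> rfl

theorem chordSign_edges {x y : V × V} (hx : G.Adj x.1 x.2) (hy : G.Adj y.1 y.2)
    (hxl : D.coords x.1 < D.coords x.2) (hyl : D.coords y.1 < D.coords y.2) (hxy : x ≠ y) :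
    chordSign (ordSign (key D)) (x, x.swap) (y, y.swap) =
      crossSign D s(x.1, x.2) s(y.1, y.2) * ((leftSign D x y.1 * leftSign D x y.2) *
        (leftSign D y x.1 * leftSign D y x.2)) := by
  obtain ⟨a, b⟩ := x
  obtain ⟨c, d⟩ := y
  have hswap : chordSign (ordSign (key D)) ((a, b), (b, a)) ((c, d), (d, c)) =
      chordSign (ordSign (key D)) ((c, d), (d, c)) ((a, b), (b, a)) := by
    have hinj := key_injOn D
    have h1 : (a, b) ≠ (d, c) := fun e => by
      obtain ⟨rfl, rfl⟩ := Prod.mk.inj e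
      exact hxl.not_gt hyl
    have h2 : (b, a) ≠ (c, d) := fun e => by
      obtain ⟨rfl, rfl⟩ := Prod.mk.inj e
      exact hxl.not_gt hyl
    have h3 : (b, a) ≠ (d, c) := fun e => by
      obtain ⟨rfl, rfl⟩ := Prod.mk.inj e
      exact hxy rfl
    exact chordSign_comm (fun e => hxy (hinj hx hy e)) (fun e => h1 (hinj hx hy.symm e))
      (fun e => h2 (hinj hx.symm hy e)) (fun e => h3 (hinj hx.symm hy.symm e))
  have hrev : (D.coords c < D.coords a ∨ c = a ∧ D.coords d < D.coords b) →
      chordSign (ordSign (key D)) ((a, b), (b, a)) ((c, d), (d, c)) =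
      crossSign D s(a, b) s(c, d) * ((leftSign D (a, b) c * leftSign D (a, b) d) *
        (leftSign D (c, d) a * leftSign D (c, d) b)) := by
    intro h
    rw [hswap, chordSign_edges_of_lt D hy hx hyl hxl h, crossSign_comm,
      mul_comm (leftSign D (c, d) a * _)]
  rcases lt_trichotomy (D.coords a) (D.coords c) with h | h | h
  · exact chordSign_edges_of_lt D hx hy hxl hyl (.inl h)
  · obtain rfl := coords_injective D h
    rcases lt_trichotomy (D.coords b) (D.coords d) with h' | h' | h'
    · exact chordSign_edges_of_lt D hx hy hxl hyl (.inr ⟨rfl, h'⟩)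
    · obtain rfl := coords_injective D h'
      exact absurd rfl hxy
    · exact hrev (.inr ⟨rfl, h'⟩)
  · exact hrev (.inl h)

open scoped Classical in
theorem card_halfEdges_at [Fintype V] (F : Finset (Sym2 V)) (v : V) :
    ((halfEdges F).filter fun x => x.1 = v).card = (F.filter fun e => v ∈ e).card := by
  refine Finset.card_bij (fun x _ => s(x.1, x.2)) ?_ ?_ ?_
  · rintro ⟨a, b⟩ h
    obtain ⟨h1, rfl⟩ := Finset.mem_filter.1 h
    exact Finset.mem_filter.2 ⟨mem_halfEdges.1 h1, Sym2.mem_mk_left _ _⟩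
  · rintro ⟨a, b⟩ h ⟨c, d⟩ h' e
    obtain ⟨h1, rfl⟩ := Finset.mem_filter.1 h
    obtain ⟨h2, e2⟩ := Finset.mem_filter.1 h'
    change c = a at e2
    subst e2
    exact Prod.ext rfl (Sym2.congr_right.1 e)
  · intro e he
    obtain ⟨h1, h2⟩ := Finset.mem_filter.1 he
    obtain ⟨w, rfl⟩ := h2
    exact ⟨(v, w), Finset.mem_filter.2 ⟨mem_halfEdges.2 h1, rfl⟩, rfl⟩

/-- For an even set of edges, the chords that represent the edges have as many crossings as the
edges, modulo two. -/
theorem matchSign_swap [Fintype V] {F : Finset (Sym2 V)} (hF : F ∈ evenSubsets G) :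
    matchSign (key D) (halfEdges F) Prod.swap = (-1) ^ D.crossings F := by
  classical
  obtain ⟨hFG, heven⟩ := Finset.mem_filter.1 hF
  have hadj : ∀ u v, s(u, v) ∈ F → G.Adj u v := fun u v h => by
    have := Finset.mem_powerset.1 hFG h
    rwa [SimpleGraph.mem_edgeFinset, SimpleGraph.mem_edgeSet] at this
  set U := leftEnds (key D) (halfEdges F) Prod.swap with hU
  have hmemU : ∀ x, x ∈ U ↔ x ∈ halfEdges F ∧ D.coords x.1 < D.coords x.2 := by
    intro x
    rw [hU, leftEnds, Finset.mem_filter]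
    refine and_congr_right fun hx => ⟨fun h => ?_, fun h => key_lt_of_coords_lt D h⟩
    by_contra h'
    rcases (not_lt.1 h').eq_or_lt with e | h''
    · exact (hadj _ _ (mem_halfEdges.1 hx)).ne (coords_injective D e).symm
    · exact (key_lt_of_coords_lt D (x := x.swap) (y := x) h'').not_gt h
  let g : V × V → V × V → ℤˣ := fun x y => leftSign D x y.1 * leftSign D x y.2
  have h1 : matchSign (key D) (halfEdges F) Prod.swap =
      pairProd (fun x y => crossSign D s(x.1, x.2) s(y.1, y.2) * (g x y * g y x)) U.toList := by
    refine pairProd_congr ((Finset.nodup_toList U).imp_of_mem fun {x y} hx hy hxy => ?_)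
    obtain ⟨hx, hxl⟩ := (hmemU x).1 (Finset.mem_toList.1 hx)
    obtain ⟨hy, hyl⟩ := (hmemU y).1 (Finset.mem_toList.1 hy)
    exact chordSign_edges D (hadj _ _ (mem_halfEdges.1 hx)) (hadj _ _ (mem_halfEdges.1 hy)) hxl hyl
      hxy
  have h2 : pairProd (fun x y => g x y * g y x) U.toList = 1 := by
    -- Over ordered pairs, the corrections for a fixed edge `x` run over all half-edges of `F`. Each
    -- vertex contributes its sign to the power of its degree in `F`, which is even.
    rw [pairProd_mul_swap]
    · rw [crossProd, Finset.prod_map_toList]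
      refine Finset.prod_eq_one fun x _ => ?_
      rw [Finset.prod_map_toList]
      have e : ∏ y ∈ U, g x y = ∏ z ∈ halfEdges F, leftSign D x z.1 := by
        simp only [g]
        rw [Finset.prod_mul_distrib, ← Finset.prod_filter_mul_prod_filter_not (halfEdges F)
          (fun x => key D x < key D x.swap)]
        congr 1
        refine Finset.prod_nbij' Prod.swap Prod.swap ?_ ?_ (fun _ _ => Prod.swap_swap _)
          (fun _ _ => Prod.swap_swap _) fun _ _ => rfl
        · intro y hy
          obtain ⟨hyH, hyl⟩ := (hmemU y).1 hy
          refine Finset.mem_filter.2 ⟨swap_mem_halfEdges.2 hyH, ?_⟩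
          rw [Prod.swap_swap]
          exact (key_lt_of_coords_lt D (x := y) (y := y.swap) hyl).not_gt
        · intro y hy
          obtain ⟨hyH, hyl⟩ := Finset.mem_filter.1 hy
          refine (hmemU _).2 ⟨swap_mem_halfEdges.2 hyH, ?_⟩
          refine lt_of_le_of_ne (not_lt.1 fun h => hyl (key_lt_of_coords_lt D h)) fun e => ?_
          exact (hadj _ _ (mem_halfEdges.1 hyH)).ne (coords_injective D e).symm
      rw [e, ← Finset.prod_fiberwise (halfEdges F) Prod.fst]
      refine Finset.prod_eq_one fun v _ => ?_
      rw [Finset.prod_congr rfl fun z hz => by rw [(Finset.mem_filter.1 hz).2],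
        Finset.prod_const, card_halfEdges_at]
      obtain ⟨k, hk⟩ := heven v
      have hk' : (F.filter fun e => v ∈ e).card = k + k := by
        convert hk
      rw [hk', pow_add, Int.units_mul_self]
    · intro x _
      simp only [g]
      rw [leftSign_of_le_left D le_rfl, leftSign_of_ge_right D le_rfl, mul_one]
  have h3 : (U.toList.map fun x => s(x.1, x.2)).Perm F.toList := by
    rw [List.perm_ext_iff_of_nodup _ (Finset.nodup_toList _)]
    · intro e
      simp only [List.mem_map, Finset.mem_toList, hmemU]
      constructor
      · rintro ⟨x, ⟨hx, -⟩, rfl⟩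
        exact mem_halfEdges.1 hx
      · induction e with | _ u v => ?_
        intro he
        rcases lt_trichotomy (D.coords u) (D.coords v) with h | h | h
        · exact ⟨(u, v), ⟨mem_halfEdges.2 he, h⟩, rfl⟩
        · exact absurd (coords_injective D h) (hadj u v he).ne
        · exact ⟨(v, u), ⟨mem_halfEdges.2 (by rwa [Sym2.eq_swap]), h⟩, Sym2.eq_swap⟩
    · rw [List.nodup_map_iff_inj_on (Finset.nodup_toList _)]
      intro x hx y hy e
      obtain ⟨-, hxl⟩ := (hmemU x).1 (Finset.mem_toList.1 hx)
      obtain ⟨-, hyl⟩ := (hmemU y).1 (Finset.mem_toList.1 hy)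
      rcases Sym2.eq_iff.1 e with ⟨e1, e2⟩ | ⟨e1, e2⟩
      · exact Prod.ext e1 e2
      · rw [e1, e2] at hxl
        exact absurd hxl hyl.not_gt
  rw [h1, pairProd_mul, h2, mul_one, ← pairProd_crossSign D F,
    ← pairProd_perm _ h3 fun x _ y _ => crossSign_comm D x y, pairProd_map]

/-- The parity of the edge chords factors out of the sum over matchings. The other factor sums to
`1`: half-edges at one vertex are consecutive for `key`, and even degrees make the blocks even. -/
theorem sum_collectionSgn [Fintype V] {F : Finset (Sym2 V)} (hF : F ∈ evenSubsets G) :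
    ∑ S ∈ D.decompositions F, D.collectionSgn S = (-1) ^ D.crossings F := by
  classical
  obtain ⟨hFG, heven⟩ := Finset.mem_filter.1 hF
  have hadj : ∀ u v, s(u, v) ∈ F → G.Adj u v := fun u v h => by
    have := Finset.mem_powerset.1 hFG h
    rwa [SimpleGraph.mem_edgeFinset, SimpleGraph.mem_edgeSet] at this
  rw [sum_decompositions_eq D hadj _ _ fun S hS f hf hfS => collectionSgn_eq D hadj hS hf hfS]
  have hsum := sum_matchSign (key D) Prod.fst (halfEdges F) (key_injOn_halfEdges D hadj) (by
    rintro x - y - z - hxy hyz hzx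
    have hle : ∀ {x y : V × V}, key D x < key D y → D.coords x.1 ≤ D.coords y.1 := by
      intro x y h
      by_contra! h'
      exact (key_lt_of_coords_lt D h').not_gt h
    have h1 := hle hxy
    have h2 := hle hyz
    rw [hzx] at h2
    exact (coords_injective D (h1.antisymm h2)).symm) (by
    intro v
    have := heven v
    rw [← card_halfEdges_at] at this
    convert this)
  simp only [Units.val_mul, Int.cast_mul]
  rw [← Finset.mul_sum, ← Int.cast_sum, hsum, matchSign_swap D hF]
  push_cast
  ring

end Crossings

/-! ### The generating function and the proof of (2) -/

section GeneratingFunction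

variable {V : Type*} {G : SimpleGraph V}

/-- A rotation by `k` that fixes the list makes steps `0` and `k` use the same edge, whence `n ∣ k`.
-/
theorem multiplicity_listOf {p : ℤ → V} {n : ℕ} (hp : IsCircuit G p n) :
    multiplicity (listOf p n) = 1 := by
  have hiter : ∀ (k : ℕ) (l : List V), (fun m : List V => m.rotate 1)^[k] l = l.rotate k := by
    intro k l
    induction k with
    | zero => simp
    | succ k ih => rw [Function.iterate_succ_apply', ih, List.rotate_rotate]
  have hper : Function.minimalPeriod (fun m : List V => m.rotate 1) (listOf p n) = n := by
    apply Nat.dvd_antisymm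
    · apply Function.IsPeriodicPt.minimalPeriod_dvd
      rw [Function.IsPeriodicPt, Function.IsFixedPt, hiter]
      simpa using List.rotate_length (listOf p n)
    · have h := Function.isPeriodicPt_minimalPeriod (fun m : List V => m.rotate 1) (listOf p n)
      rw [Function.IsPeriodicPt, Function.IsFixedPt, hiter, rotate_listOf hp.periodic] at h
      generalize Function.minimalPeriod (fun m : List V => m.rotate 1) (listOf p n) = k at h
      have e := eq_of_listOf_eq hp.pos (hp.shift k).periodic hp.periodic h
      have h1 := hp.inj (0 + k) 0
      have e0 := congrFun e 0
      have e1 := congrFun e (0 + 1)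
      rw [add_right_comm] at e1
      have := h1 (congrArg₂ (fun u v => s(u, v)) e0 e1)
      rw [zero_add, sub_zero] at this
      exact_mod_cast this
  rw [multiplicity, hper, length_listOf, Nat.div_self hp.pos]

theorem weight_eq (D : Drawing G) (x : Sym2 V → ℂ) {l : List V} (hl : D.IsLoop l)
    (hd : IsEdgeDisjoint l) : D.weight x l = D.sgn l * ∏ e ∈ loopEdges l, x e := by
  classical
  obtain ⟨p, n, hp, rfl⟩ := exists_isCircuit hl.1 hd
  rw [Drawing.weight, multiplicity_listOf hp, Nat.cast_one, div_one, loopEdges]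
  congr 1
  convert (List.prod_toFinset x hd).symm

/-- A circuit is not contained in a forest. -/
theorem IsCircuit.not_forall_mem {p : ℤ → V} {n : ℕ} (hp : IsCircuit G p n) {A : Set (Sym2 V)}
    (hA : (SimpleGraph.fromEdgeSet A).IsAcyclic) : ¬ ∀ i, s(p i, p (i + 1)) ∈ A := by
  intro h
  have hadj : ∀ i, (SimpleGraph.fromEdgeSet A).Adj (p i) (p (i + 1)) := fun i =>
    (SimpleGraph.fromEdgeSet_adj A).2 ⟨h i, (hp.adj i).ne⟩
  -- The first edge would be a bridge of the forest, but the other steps, which avoid it, join its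
  -- ends.
  have hb := SimpleGraph.isBridge_iff.1
    (SimpleGraph.isAcyclic_iff_forall_adj_isBridge.1 hA (hadj 0))
  apply hb
  have hreach : ∀ k : ℕ, k + 1 ≤ n → ((SimpleGraph.fromEdgeSet A).deleteEdges
      {s(p 0, p (0 + 1))}).Reachable (p (0 + 1)) (p (k + 1)) := by
    intro k
    induction k with
    | zero => intro _; simp
    | succ k ih =>
      intro hk
      refine (ih (by omega)).trans (SimpleGraph.Adj.reachable ?_)
      rw [SimpleGraph.deleteEdges_adj]
      push_cast
      refine ⟨hadj _, fun e => ?_⟩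
      have hd := hp.inj _ _ (Set.mem_singleton_iff.1 e)
      rw [sub_zero] at hd
      have := Int.le_of_dvd (by omega) hd
      omega
  have hpos := hp.pos
  have h1 := hreach (n - 1) (by omega)
  rw [show ((n - 1 : ℕ) : ℤ) + 1 = 0 + n by omega, hp.periodic] at h1
  exact h1.symm

variable [Fintype V] (D : Drawing G)

-- The transitions pair off the half-edges at `v` without fixed points, so `-1` to the power of the
-- degree is `1`.
open scoped Classical in
theorem biUnion_mem_evenSubsets {S : Finset (List V)} (hS : S ∈ D.edgeDisjointCollections) :
    S.biUnion loopEdges ∈ evenSubsets G := by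
  have hdec : S ∈ D.decompositions (S.biUnion loopEdges) :=
    (mem_decompositions D).2 ⟨hS, fun e => Finset.mem_biUnion⟩
  rw [evenSubsets, Finset.mem_filter, Finset.mem_powerset]
  constructor
  · intro e he
    obtain ⟨l, hl, he⟩ := Finset.mem_biUnion.1 he
    obtain ⟨p, n, hp, rfl⟩ := exists_isCircuit_of_mem D hS hl
    obtain ⟨i, rfl⟩ := (mem_loopEdges_listOf hp).1 he
    rw [SimpleGraph.mem_edgeFinset, SimpleGraph.mem_edgeSet]
    exact hp.adj i
  · intro v
    obtain ⟨f, hf, -⟩ := exists_matching D hdec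
    have h := Finset.prod_involution (s := (halfEdges (S.biUnion loopEdges)).filter
      fun x => x.1 = v) (f := fun _ => (-1 : ℤ)) (fun x _ => f x) (by simp)
      (fun x hx _ => apply_ne_of_mem_matchings hf (Finset.mem_filter.1 hx).1)
      (fun x hx => Finset.mem_filter.2
        ⟨apply_mem_of_mem_matchings hf (Finset.mem_filter.1 hx).1, by
          rw [(mem_matchings.1 hf).2.2, (Finset.mem_filter.1 hx).2]⟩)
      (fun x _ => (mem_matchings.1 hf).1 x)
    rw [Finset.prod_const, card_halfEdges_at] at h
    convert (neg_one_pow_eq_one_iff_even (by norm_num)).1 h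

theorem prod_weight_eq (x : Sym2 V → ℂ) {F : Finset (Sym2 V)} {S : Finset (List V)}
    (hS : S ∈ D.decompositions F) :
    ∏ l ∈ S, D.weight x l = D.collectionSgn S * ∏ e ∈ F, x e := by
  classical
  obtain ⟨hS, hF⟩ := (mem_decompositions D).1 hS
  obtain ⟨h1, h2⟩ := (mem_edgeDisjointCollections D).1 hS
  have hF : F = S.biUnion loopEdges := by
    ext e
    rw [hF, Finset.mem_biUnion]
  rw [Finset.prod_congr rfl fun l hl => weight_eq D x (h1 l hl).1 (h1 l hl).2,
    Finset.prod_mul_distrib, Drawing.collectionSgn, hF, Finset.prod_biUnion]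
  intro l hl l' hl' hne
  exact h2 l hl l' hl' hne

/-- Each collection covers exactly one set of edges, which is even; for each such set, (1) evaluates
the sum of signs. -/
theorem Z_eq_sum_prod_weight (x : Sym2 V → ℂ) :
    D.Z x = ∑ S ∈ D.edgeDisjointCollections, ∏ l ∈ S, D.weight x l := by
  classical
  rw [← Finset.sum_fiberwise_of_maps_to fun S hS => biUnion_mem_evenSubsets D hS, Drawing.Z]
  refine Finset.sum_congr rfl fun F hF => ?_
  rw [← sum_collectionSgn D hF, Finset.sum_mul, Drawing.decompositions]
  refine Finset.sum_congr (by congr!) fun S hS => (prod_weight_eq D x ?_).symm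
  rw [Drawing.decompositions]
  convert hS

theorem collectionsOfLength_zero {A : Finset (Sym2 V)}
    (hA : (SimpleGraph.fromEdgeSet (A : Set (Sym2 V))).IsAcyclic) :
    D.collectionsOfLength A 0 = {∅} := by
  classical
  ext S
  rw [Drawing.collectionsOfLength, Finset.mem_filter, Finset.mem_singleton]
  constructor
  · rintro ⟨hS, hlen⟩
    by_contra hne
    obtain ⟨l, hl⟩ := Finset.nonempty_iff_ne_empty.2 hne
    have h0 := Finset.sum_eq_zero_iff.1 hlen l hl
    obtain ⟨p, n, hp, rfl⟩ := exists_isCircuit_of_mem D hS hl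
    refine hp.not_forall_mem hA fun i => ?_
    have hi := (mem_loopEdges_listOf hp).2 ⟨i, rfl⟩
    rw [loopEdges, List.mem_toFinset] at hi
    rw [loopLength, List.countP_eq_zero] at h0
    simpa using h0 _ hi
  · rintro rfl
    exact ⟨(mem_edgeDisjointCollections D).2 ⟨by simp, by simp⟩, by simp⟩

/-- There are finitely many collections, so their lengths are bounded by some `N` and the later
terms vanish. Starting at `r + 1` omits the empty collection, whose product is `1`. -/
theorem hasSum_collectionsOfLength {A : Finset (Sym2 V)}
    (hA : (SimpleGraph.fromEdgeSet (A : Set (Sym2 V))).IsAcyclic) (x : Sym2 V → ℂ) :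
    HasSum (fun r : ℕ => ∑ S ∈ D.collectionsOfLength A (r + 1), ∏ l ∈ S, D.weight x l)
      (D.Z x - 1) := by
  classical
  set len : Finset (List V) → ℕ := fun S => ∑ l ∈ S, loopLength A l with hlen
  have hmem : ∀ r S, S ∈ D.collectionsOfLength A r ↔ S ∈ D.edgeDisjointCollections ∧ len S = r := by
    intro r S
    rw [Drawing.collectionsOfLength, Finset.mem_filter]
  set N := D.edgeDisjointCollections.sup len with hN
  have hle : ∀ S ∈ D.edgeDisjointCollections, len S ≤ N := fun S hS => Finset.le_sup hS
  have hZ : D.Z x = ∑ r ∈ Finset.range (N + 1),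
      ∑ S ∈ D.collectionsOfLength A r, ∏ l ∈ S, D.weight x l := by
    rw [Z_eq_sum_prod_weight, ← Finset.sum_fiberwise_of_maps_to (g := len)
      (t := Finset.range (N + 1)) fun S hS => Finset.mem_range.2 (Nat.lt_succ_of_le (hle S hS))]
    refine Finset.sum_congr rfl fun r _ => Finset.sum_congr ?_ fun _ _ => rfl
    ext S
    rw [hmem, Finset.mem_filter]
  rw [hZ, Finset.sum_range_succ', collectionsOfLength_zero D hA, Finset.sum_singleton,
    Finset.prod_empty, add_sub_cancel_right]
  apply hasSum_sum_of_ne_finset_zero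
  intro r hr
  rw [Finset.mem_range, not_lt] at hr
  rw [Finset.sum_eq_zero]
  intro S hS
  obtain ⟨h1, h2⟩ := (hmem _ S).1 hS
  have := hle S h1
  omega

end GeneratingFunction

end SignedLoops

theorem mainTheorem12 {V : Type*} [Fintype V] (G : SimpleGraph V) (D : SignedLoops.Drawing G) :
    (∀ F ∈ SignedLoops.evenSubsets G,
      ∑ S ∈ D.decompositions F, D.collectionSgn S = (-1) ^ D.crossings F) ∧
    (∀ (A : Finset (Sym2 V)), (A : Set (Sym2 V)) ⊆ G.edgeSet →
      (SimpleGraph.fromEdgeSet (A : Set (Sym2 V))).IsAcyclic →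
      ∀ x : Sym2 V → ℂ,
        Summable (fun r : ℕ => ∑ S ∈ D.collectionsOfLength A (r + 1), ∏ l ∈ S, D.weight x l) ∧
        D.Z x = 1 + ∑' r : ℕ, ∑ S ∈ D.collectionsOfLength A (r + 1), ∏ l ∈ S, D.weight x l) := by
  refine ⟨fun F hF => SignedLoops.sum_collectionSgn D hF, fun A _ hA x => ?_⟩
  have h := SignedLoops.hasSum_collectionsOfLength D hA x
  exact ⟨h.summable, by rw [h.tsum_eq, add_sub_cancel]⟩
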